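/- **Local Ising sampler.** For a finite simple graph $G=(V,E)$, external fields $\lambda_v\in\mathbb{R}_{\ge 0}^2\setminus\{0\}$ ($v\in V$) and an edge activity $\beta>0$, the Ising model is the 2-spin system with interaction matrix $A=\begin{pmatrix}\beta&1\\1&\beta\end{pmatrix}$ at every edge, so its Gibbs distribution $\mu$ is the probability distribution on the configurations $\sigma$ that assign to each vertex one of the two spins, with $$\mu(\sigma)\ \propto\ \prod_{v\in V}\lambda_v(\sigma(v))\prod_{\{u,v\}\in E}A(\sigma(u),\sigma(v)).$$ For $\Lambda\subseteq V$ let $\mu_\Lambda$ be the marginal distribution of $\mu$ on $\Lambda$. There is a single randomized algorithm with the following property. It is given a set $\Lambda\subseteq V$, listed in an array, and probe access to an Ising model on a graph with maximum degree $\Delta\ge 1$, with arbitrary external fields $\lambda_v$ and with edge activity $$\beta\in\left(\frac{\Delta-0.5}{\Delta},\ \frac{\Delta}{\Delta-0.5}\right);$$ that is, $|V|$, $|\Lambda|$, the degree of a vertex, each entry of its adjacency list, each entry of each $\lambda_v$, the value $\beta$ and each entry of the array $\Lambda$ can be retrieved in unit time. The algorithm outputs a perfect sample $X\sim\mu_\Lambda$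 in expected time $O(\Delta\cdot|\Lambda|)$ (read as $O(1)$ if $\Lambda=\emptyset$), where the hidden constant is absolute. Time is the number of steps of a unit-cost random-access machine that holds natural numbers (with addition, truncated subtraction and comparison) and real numbers (with the four arithmetic operations and comparison), and that can draw a fresh uniform random real from $[0,1]$ in one step. -/

import Mathlib

open MeasureTheory
open scoped ENNReal

noncomputable section

namespace Ising

/-! ### The Ising model -/

/-- The interaction matrix of the Ising model with edge activity `β`. -/
def interaction (β : ℝ) : Matrix (Fin 2) (Fin 2) ℝ := !![β, 1; 1, β]

theorem interaction_symm (β : ℝ) (a b : Fin 2) : interaction β a b = interaction β b a := by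
  fin_cases a <;> fin_cases b <;> rfl

/-- The factor `A_e(σ(u), σ(v))` contributed by the pair `e = {u, v}` to the weight of `σ`. -/
def edgeFactor {V : Type*} (β : ℝ) (σ : V → Fin 2) : Sym2 V → ℝ :=
  Sym2.lift ⟨fun u v => interaction β (σ u) (σ v), fun _ _ => interaction_symm β _ _⟩

variable {V : Type*} [Fintype V] [DecidableEq V]

/-- `w(σ) = ∏_{v ∈ V} λ_v(σ(v)) ∏_{e = {u,v} ∈ E} A_e(σ(u), σ(v))`. -/
def weight (G : SimpleGraph V) [DecidableRel G.Adj] (lam : V → Fin 2 → ℝ) (β : ℝ)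
    (σ : V → Fin 2) : ℝ :=
  (∏ v, lam v (σ v)) * ∏ e ∈ G.edgeFinset, edgeFactor β σ e

/-- The partition function `Z`. -/
def partitionFunction (G : SimpleGraph V) [DecidableRel G.Adj] (lam : V → Fin 2 → ℝ)
    (β : ℝ) : ℝ :=
  ∑ σ : V → Fin 2, weight G lam β σ

/-- The Gibbs distribution `μ(σ) = w(σ) / Z`. -/
def gibbs (G : SimpleGraph V) [DecidableRel G.Adj] (lam : V → Fin 2 → ℝ) (β : ℝ)
    (σ : V → Fin 2) : ℝ :=
  weight G lam β σ / partitionFunction G lam β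

/-- The marginal distribution `μ_Λ(τ) = ∑_{σ : σ_Λ = τ} μ(σ)`. -/
def marginal (G : SimpleGraph V) [DecidableRel G.Adj] (lam : V → Fin 2 → ℝ) (β : ℝ)
    (Λ : Finset V) (τ : Λ → Fin 2) : ℝ :=
  ∑ σ : V → Fin 2 with (∀ v : Λ, σ v = τ v), gibbs G lam β σ

end Ising

/-! ### A randomized unit-cost random-access machine with probe access to an Ising model

The machine works with natural numbers (vertices, spins `0` and `1`, addresses) and with real
numbers. A program is a finite list of instructions that does not depend on the input; the input is
read only through probe instructions. Every instruction costs one unit of time. -/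

namespace RAM

/-- The data that the machine can probe. The vertices are `0, …, n - 1`. -/
structure Input where
  /-- the number of vertices -/
  n : ℕ
  /-- the adjacency list of each vertex -/
  adj : Fin n → List (Fin n)
  /-- the external fields -/
  field : Fin n → Fin 2 → ℝ
  /-- the edge activity -/
  activity : ℝ
  /-- the array of queried vertices -/
  query : List (Fin n)

namespace Input

/-- The number of neighbours of vertex `v` (`0` if there is no such vertex). -/
def degree (I : Input) (v : ℕ) : ℕ :=
  if h : v < I.n then (I.adj ⟨v, h⟩).length else 0

/-- The `k`-th entry in the adjacency list of `v` (`0` if there is no such entry). -/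
def neighbor (I : Input) (v k : ℕ) : ℕ :=
  if h : v < I.n then ((I.adj ⟨v, h⟩).map Fin.val).getD k 0 else 0

/-- The entry `λ_v(c)` of the external field (`0` if there is no such entry). -/
def fieldAt (I : Input) (v c : ℕ) : ℝ :=
  if h : v < I.n ∧ c < 2 then I.field ⟨v, h.1⟩ ⟨c, h.2⟩ else 0

/-- The `k`-th queried vertex (`0` if there is no such vertex). -/
def queryAt (I : Input) (k : ℕ) : ℕ := (I.query.map Fin.val).getD k 0

end Input

/-- The instructions. The letters `i j k` name registers that hold natural numbers, `a b c` name
registers that hold reals, `l` is a position in the program. -/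
inductive Instr where
  /-- `i := m` -/
  | const (i m : ℕ)
  /-- `i := j + k` -/
  | add (i j k : ℕ)
  /-- `i := j - k`, truncated at zero -/
  | sub (i j k : ℕ)
  /-- `i := memory[j]` -/
  | load (i j : ℕ)
  /-- `memory[i] := j` -/
  | store (i j : ℕ)
  /-- go to `l` -/
  | jump (l : ℕ)
  /-- if `i < j` go to `l` -/
  | jumpLt (i j l : ℕ)
  /-- `a := x` for a rational constant `x` -/
  | rconst (a : ℕ) (x : ℚ)
  /-- `a := b + c` -/
  | radd (a b c : ℕ)
  /-- `a := b - c` -/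
  | rsub (a b c : ℕ)
  /-- `a := b * c` -/
  | rmul (a b c : ℕ)
  /-- `a := b / c`, which is `0` for `c = 0` -/
  | rdiv (a b c : ℕ)
  /-- `a := realMemory[j]` -/
  | rload (a j : ℕ)
  /-- `realMemory[i] := b` -/
  | rstore (i b : ℕ)
  /-- if `a < b` go to `l` -/
  | rjumpLt (a b l : ℕ)
  /-- `a :=` a fresh uniform sample from `[0,1]` -/
  | rand (a : ℕ)
  /-- `i :=` the number of vertices -/
  | getSize (i : ℕ)
  /-- `i :=` the degree of vertex `j` -/
  | getDegree (i j : ℕ)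
  /-- `i :=` the `k`-th neighbour of vertex `j` -/
  | getNeighbor (i j k : ℕ)
  /-- `a := λ_j(k)` -/
  | getField (a j k : ℕ)
  /-- `a := β` -/
  | getActivity (a : ℕ)
  /-- `i :=` the number of queried vertices -/
  | getQuerySize (i : ℕ)
  /-- `i :=` the `j`-th queried vertex -/
  | getQuery (i j : ℕ)
  /-- `X(i) := j` for the output configuration `X` -/
  | output (i j : ℕ)

/-- A program is a finite list of instructions. -/
abbrev Program := List Instr

/-- A configuration of the machine. -/
structure State where
  /-- position of the next instruction -/
  pc : ℕ
  /-- registers for natural numbers -/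
  reg : ℕ → ℕ
  /-- registers for reals -/
  rreg : ℕ → ℝ
  /-- memory for natural numbers -/
  mem : ℕ → ℕ
  /-- memory for reals -/
  rmem : ℕ → ℝ
  /-- the partial configuration written so far -/
  out : ℕ → Option ℕ

namespace State

/-- At the start all registers and memory cells are zero and no output is written. -/
def init : State where
  pc := 0
  reg := fun _ => 0
  rreg := fun _ => 0
  mem := fun _ => 0
  rmem := fun _ => 0
  out := fun _ => none

/-- Write a natural number to a register and pass to the next instruction. -/
def setReg (s : State) (i x : ℕ) : State :=
  { s with pc := s.pc + 1, reg := Function.update s.reg i x }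

/-- Write a real number to a register and pass to the next instruction. -/
def setReal (s : State) (a : ℕ) (x : ℝ) : State :=
  { s with pc := s.pc + 1, rreg := Function.update s.rreg a x }

/-- Go to `l` if `p` holds, otherwise pass to the next instruction. -/
def branch (s : State) (p : Prop) [Decidable p] (l : ℕ) : State :=
  { s with pc := if p then l else s.pc + 1 }

end State

/-- The effect of one instruction; `u` is the random number that is available in this step. -/
def exec (I : Input) (u : unitInterval) (s : State) : Instr → State
  | .const i m => s.setReg i m
  | .add i j k => s.setReg i (s.reg j + s.reg k)
  | .sub i j k => s.setReg i (s.reg j - s.reg k)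
  | .load i j => s.setReg i (s.mem (s.reg j))
  | .store i j => { s with pc := s.pc + 1, mem := Function.update s.mem (s.reg i) (s.reg j) }
  | .jump l => s.branch True l
  | .jumpLt i j l => s.branch (s.reg i < s.reg j) l
  | .rconst a x => s.setReal a (x : ℝ)
  | .radd a b c => s.setReal a (s.rreg b + s.rreg c)
  | .rsub a b c => s.setReal a (s.rreg b - s.rreg c)
  | .rmul a b c => s.setReal a (s.rreg b * s.rreg c)
  | .rdiv a b c => s.setReal a (s.rreg b / s.rreg c)
  | .rload a j => s.setReal a (s.rmem (s.reg j))
  | .rstore i b => { s with pc := s.pc + 1, rmem := Function.update s.rmem (s.reg i) (s.rreg b) }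
  | .rjumpLt a b l => s.branch (s.rreg a < s.rreg b) l
  | .rand a => s.setReal a (u : ℝ)
  | .getSize i => s.setReg i I.n
  | .getDegree i j => s.setReg i (I.degree (s.reg j))
  | .getNeighbor i j k => s.setReg i (I.neighbor (s.reg j) (s.reg k))
  | .getField a j k => s.setReal a (I.fieldAt (s.reg j) (s.reg k))
  | .getActivity a => s.setReal a I.activity
  | .getQuerySize i => s.setReg i I.query.length
  | .getQuery i j => s.setReg i (I.queryAt (s.reg j))
  | .output i j =>
      { s with pc := s.pc + 1, out := Function.update s.out (s.reg i) (some (s.reg j)) }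

/-- The machine halts when it leaves the program. -/
def Halted (P : Program) (s : State) : Prop := P.length ≤ s.pc

/-- One step of the machine; a halted machine does not change its state. -/
def step (P : Program) (I : Input) (u : unitInterval) (s : State) : State :=
  match P[s.pc]? with
  | none => s
  | some ins => exec I u s ins

/-- The state after `t` steps, when `ω t` is the random number available in step `t`. -/
def run (P : Program) (I : Input) (ω : ℕ → unitInterval) : ℕ → State
  | 0 => State.init
  | t + 1 => step P I (ω t) (run P I ω t)

/-- The law of the random numbers: independent and uniform on `[0,1]`. -/
def tapeMeasure : Measure (ℕ → unitInterval) :=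
  Measure.infinitePi fun _ => (volume : Measure unitInterval)

/-- The number of steps until the machine halts (`⊤` if it never halts). -/
def runtime (P : Program) (I : Input) (ω : ℕ → unitInterval) : ℝ≥0∞ :=
  ⨅ (t : ℕ) (_ : Halted P (run P I ω t)), (t : ℝ≥0∞)

/-- The machine halts, and the configuration it has written is exactly `τ`: it has written the spin
`τ v` at each vertex `v` of `Λ`, and nothing elsewhere. -/
def Outputs (P : Program) (I : Input) {n : ℕ} {Λ : Finset (Fin n)} (τ : Λ → Fin 2)
    (ω : ℕ → unitInterval) : Prop :=
  ∃ t : ℕ, Halted P (run P I ω t) ∧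
    (∀ v : Λ, (run P I ω t).out (v : Fin n).val = some (τ v).val) ∧
    ∀ m : ℕ, (∀ v ∈ Λ, v.val ≠ m) → (run P I ω t).out m = none

end RAM

end

/-! Up to the constant factor max(1, β), an edge is a mixture. With probability p = min(β, 1/β) ≥ 1
− 1/(2Δ) (`slack`) it imposes nothing; with probability 1 − p it demands equal spins (β ≥ 1) or
different spins (β < 1). Hence the spin of v given its neighbours can be drawn by rejection: propose
c with probability proportional to λ_v(c), toss a coin for each edge, and restart when a demand is
violated. The spin of a neighbour is needed only if its edge makes a demand. If it is unknown, it is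
drawn recursively, conditional on all pins made so far and with v left free. It stays pinned until
the loop at v accepts, and then it is forgotten.

Correctness rests on two facts. Revealing a spin from its conditional law changes no expectation
(`condExp_reveal`), and resampling v given its neighbours is a step in detailed balance, so v keeps
its conditional marginal (`condExp_resample`).

For the cost, restarts keep the pins, so a loop reveals each free neighbour at most once. The
budgets show that it does so with probability at most r = 8/(9Δ) (`trigger_le`). A call thus makes
at most 8/9 recursive calls on average. The recursion is a subcritical branching process, and its
total cost is at most nine times the local cost O(Δ) (`loopCost_le_callCost`).

On the machine both statements come from one functional, `value`: κ times the running time plus a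
final reward F, cut off after k steps. The cut-off makes unbounded recursion accessible to induction
on k (`loopBound_succ`, `LoopBound.sampleBound`). Only upper bounds are proved. With κ = 1, F = 0
they bound the expected time, so the machine halts almost surely. With κ = 0 they bound the
probabilities of an output event and of its complement; since these add up to one, both bounds are
equalities (`measure_outputs`). -/

noncomputable section

namespace LocalSampler

/-! ### Conditional expectations under partially pinned configurations

A function `g : ℕ → ℝ` encodes a partial configuration: the vertex `u` has spin `1` if `0 < g u`,
spin `0` if `g u < 0`, and is free if `g u = 0`. -/

/-- The configuration `σ` extends the partial configuration `g`. -/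
def Agrees {n : ℕ} (g : ℕ → ℝ) (σ : Fin n → Fin 2) : Prop :=
  ∀ u : Fin n, (0 < g u → σ u = 1) ∧ (g u < 0 → σ u = 0)

/-- The pin with spin `b` and absolute value `D`. -/
def pin (D : ℝ) (b : Fin 2) : ℝ := if b = 0 then 0 - D else D

theorem pin_ne_zero {D : ℝ} (hD : 0 < D) (b : Fin 2) : pin D b ≠ 0 := by
  unfold pin; split_ifs <;> linarith

theorem abs_pin {D : ℝ} (hD : 0 < D) (b : Fin 2) : |pin D b| = D := by
  unfold pin; split_ifs <;> simp [abs_of_pos hD]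

theorem pin_pos_iff {D : ℝ} (hD : 0 < D) (b : Fin 2) : 0 < pin D b ↔ b = 1 := by
  fin_cases b <;> simp [pin, hD, hD.le]

theorem pin_neg_iff {D : ℝ} (hD : 0 < D) (b : Fin 2) : pin D b < 0 ↔ b = 0 := by
  fin_cases b <;> simp [pin, hD, hD.le]

open Classical in
/-- The weight `w` restricted to the extensions of `g`. -/
def pinned {n : ℕ} (w : (Fin n → Fin 2) → ℝ) (g : ℕ → ℝ) (σ : Fin n → Fin 2) : ℝ :=
  if Agrees g σ then w σ else 0

/-- The expectation of `F` under the distribution proportional to `w`, conditional on `g`. -/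
def condExp {n : ℕ} (w : (Fin n → Fin 2) → ℝ) (g : ℕ → ℝ) (F : (Fin n → Fin 2) → ℝ) : ℝ :=
  (∑ σ, pinned w g σ * F σ) / ∑ σ, pinned w g σ

section

variable {n : ℕ} {w : (Fin n → Fin 2) → ℝ} {g : ℕ → ℝ}

theorem pinned_nonneg (hw : ∀ σ, 0 ≤ w σ) (g : ℕ → ℝ) (σ : Fin n → Fin 2) : 0 ≤ pinned w g σ := by
  unfold pinned; split_ifs
  exacts [hw σ, le_rfl]

theorem condExp_nonneg (hw : ∀ σ, 0 ≤ w σ) {F : (Fin n → Fin 2) → ℝ} (hF : ∀ σ, 0 ≤ F σ) :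
    0 ≤ condExp w g F :=
  div_nonneg (Finset.sum_nonneg fun σ _ => mul_nonneg (pinned_nonneg hw g σ) (hF σ))
    (Finset.sum_nonneg fun σ _ => pinned_nonneg hw g σ)

theorem condExp_congr {F H : (Fin n → Fin 2) → ℝ} (h : ∀ σ, Agrees g σ → F σ = H σ) :
    condExp w g F = condExp w g H := by
  unfold condExp
  congr 1
  refine Finset.sum_congr rfl fun σ _ => ?_
  unfold pinned
  split_ifs with hσ
  · rw [h σ hσ]
  · simp

theorem condExp_add (F H : (Fin n → Fin 2) → ℝ) :
    condExp w g (fun σ => F σ + H σ) = condExp w g F + condExp w g H := by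
  simp only [condExp, mul_add, Finset.sum_add_distrib, add_div]

theorem condExp_const_mul (a : ℝ) (F : (Fin n → Fin 2) → ℝ) :
    condExp w g (fun σ => a * F σ) = a * condExp w g F := by
  simp only [condExp, mul_left_comm _ a, ← Finset.mul_sum, mul_div_assoc]

theorem condExp_const (hZ : 0 < ∑ σ, pinned w g σ) (a : ℝ) :
    condExp w g (fun _ => a) = a := by
  simp only [condExp, ← Finset.sum_mul]
  field_simp

theorem agrees_update {u : Fin n} (hu : g u = 0) {D : ℝ} (hD : 0 < D) (b : Fin 2)
    (σ : Fin n → Fin 2) :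
    Agrees (Function.update g u (pin D b)) σ ↔ Agrees g σ ∧ σ u = b := by
  constructor
  · intro h
    refine ⟨fun x => ?_, ?_⟩
    · by_cases hx : x = u
      · subst hx; simp [hu]
      · have := h x
        rwa [Function.update_of_ne (by simpa [Fin.ext_iff] using hx)] at this
    · have := h u
      rw [Function.update_self, pin_pos_iff hD, pin_neg_iff hD] at this
      fin_cases b
      · exact this.2 rfl
      · exact this.1 rfl
  · rintro ⟨h, rfl⟩ x
    by_cases hx : x = u
    · subst hx
      rw [Function.update_self, pin_pos_iff hD, pin_neg_iff hD]
      exact ⟨id, id⟩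
    · rw [Function.update_of_ne (by simpa [Fin.ext_iff] using hx)]
      exact h x

theorem pinned_update {u : Fin n} (hu : g u = 0) {D : ℝ} (hD : 0 < D) (b : Fin 2)
    (σ : Fin n → Fin 2) :
    pinned w (Function.update g u (pin D b)) σ = if σ u = b then pinned w g σ else 0 := by
  have h := agrees_update hu hD b σ
  unfold pinned
  split_ifs <;> simp_all

/-- The tower property: revealing the spin of `u` first does not change the expectation. -/
theorem condExp_reveal (hw : ∀ σ, 0 ≤ w σ) {u : Fin n} (hu : g u = 0) {D : ℝ} (hD : 0 < D)
    (F : (Fin n → Fin 2) → ℝ) :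
    condExp w g (fun σ => condExp w (Function.update g u (pin D (σ u))) F) = condExp w g F := by
  unfold condExp
  congr 1
  set Z : Fin 2 → ℝ := fun b => ∑ σ, pinned w (Function.update g u (pin D b)) σ
  set N : Fin 2 → ℝ := fun b => ∑ σ, pinned w (Function.update g u (pin D b)) σ * F σ
  -- A spin b of conditional weight zero is harmless: the quotient is 0 by convention, and its
  -- numerator vanishes as well.
  have hN : ∀ b, Z b * (N b / Z b) = N b := by
    intro b
    by_cases h : Z b = 0
    · have h0 : ∀ σ, pinned w (Function.update g u (pin D b)) σ = 0 := fun σ =>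
        (Finset.sum_eq_zero_iff_of_nonneg fun σ _ => pinned_nonneg hw _ σ).1 h σ (Finset.mem_univ σ)
      simp [h, N, h0]
    · field_simp
  calc ∑ σ, pinned w g σ * (N (σ u) / Z (σ u))
      = ∑ σ, ∑ b, pinned w (Function.update g u (pin D b)) σ * (N b / Z b) := by
        refine Finset.sum_congr rfl fun σ _ => ?_
        simp [pinned_update hu hD, ite_mul]
    _ = ∑ b, N b := by
        rw [Finset.sum_comm]
        refine Finset.sum_congr rfl fun b _ => ?_
        rw [← Finset.sum_mul, hN]
    _ = ∑ σ, pinned w g σ * F σ := by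
        simp only [N]
        rw [Finset.sum_comm]
        refine Finset.sum_congr rfl fun σ _ => ?_
        simp [pinned_update hu hD, ite_mul]

/-- Exchanging the spin at v with the spare spin is an involution on pairs (configuration, spin),
and the spare spin has two values. -/
theorem sum_sum_update (v : Fin n) (F : (Fin n → Fin 2) → ℝ) :
    ∑ σ : Fin n → Fin 2, ∑ c, F (Function.update σ v c) = 2 * ∑ σ, F σ := by
  let e : (Fin n → Fin 2) × Fin 2 ≃ (Fin n → Fin 2) × Fin 2 :=
    { toFun := fun p => (Function.update p.1 v p.2, p.1 v)
      invFun := fun p => (Function.update p.1 v p.2, p.1 v)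
      left_inv := fun p => by simp
      right_inv := fun p => by simp }
  have h := Equiv.sum_comp e (fun p => F p.1)
  rw [Fintype.sum_prod_type, Fintype.sum_prod_type] at h
  refine h.trans ?_
  simp [Finset.mul_sum]

theorem agrees_update_config {v : Fin n} (hv : g v = 0) (σ : Fin n → Fin 2) (c : Fin 2) :
    Agrees g (Function.update σ v c) ↔ Agrees g σ := by
  refine forall_congr' fun u => ?_
  by_cases hu : u = v
  · subst hu; simp [hv]
  · rw [Function.update_of_ne hu]

/-- Resampling the free vertex `v` by a rule in detailed balance with `w` does not change its law. -/
theorem condExp_resample {v : Fin n} (hv : g v = 0) (m : Fin 2 → (Fin n → Fin 2) → ℝ)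
    (hm : ∀ σ, (∑ c, m c σ) ≠ 0) (hmv : ∀ σ c b, m c (Function.update σ v b) = m c σ)
    (hbal : ∀ σ c b, w (Function.update σ v c) * m b σ = w (Function.update σ v b) * m c σ)
    (B : Fin 2 → ℝ) :
    condExp w g (fun σ => (∑ c, m c σ * B c) / ∑ c, m c σ) = condExp w g (fun σ => B (σ v)) := by
  unfold condExp
  congr 1
  -- The sums are compared on each fibre of configurations that differ only at v. There `m` is
  -- constant, so detailed balance matches the two sides term by term.
  have key : ∀ σ, ∑ b, pinned w g (Function.update σ v b) * ((∑ c, m c (Function.update σ v b) * B c)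
        / ∑ c, m c (Function.update σ v b))
      = ∑ c, pinned w g (Function.update σ v c) * B (Function.update σ v c v) := by
    intro σ
    simp only [hmv, Function.update_self]
    by_cases hσ : Agrees g σ
    · have hp : ∀ b, pinned w g (Function.update σ v b) = w (Function.update σ v b) := fun b =>
        if_pos ((agrees_update_config hv σ b).2 hσ)
      simp only [hp]
      rw [← Finset.sum_mul, ← mul_div_assoc, div_eq_iff (hm σ), Finset.sum_mul_sum, Finset.sum_mul]
      rw [Finset.sum_comm]
      refine Finset.sum_congr rfl fun c _ => ?_
      rw [Finset.mul_sum]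
      refine Finset.sum_congr rfl fun b _ => ?_
      linear_combination B c * hbal σ b c
    · have hp : ∀ b, pinned w g (Function.update σ v b) = 0 := fun b =>
        if_neg (mt (agrees_update_config hv σ b).1 hσ)
      simp [hp]
  have := Finset.sum_congr rfl fun σ (_ : σ ∈ Finset.univ) => key σ
  rw [sum_sum_update v (fun σ => pinned w g σ * ((∑ c, m c σ * B c) / ∑ c, m c σ)),
    sum_sum_update v (fun σ => pinned w g σ * B (σ v))] at this
  linarith

end

/-! ### Models -/

/-- The data of an Ising model in the form in which the sampler uses it. -/
structure Model (n : ℕ) where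
  adj : Fin n → List (Fin n)
  lam : Fin n → Fin 2 → ℝ
  β : ℝ
  query : List (Fin n)
  Δ : ℕ
  w : (Fin n → Fin 2) → ℝ

namespace Model

variable {n : ℕ} (M : Model n)

/-- The input of the machine that belongs to the model. -/
def input : RAM.Input := ⟨n, M.adj, M.lam, M.β, M.query⟩

/-- The probability that an edge imposes no constraint. -/
def slack : ℝ := if M.β < 1 then M.β else 1 / M.β

/-- The spins `c`, `b` are allowed at the ends of an edge that imposes its constraint. -/
def Accepts (c b : Fin 2) : Prop := if M.β < 1 then c ≠ b else c = b

open Classical in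
/-- The probability that an edge with spins `c`, `b` is passed. -/
def pass (c b : Fin 2) : ℝ := M.slack + (1 - M.slack) * if M.Accepts c b then 1 else 0

/-- The probability that all edges to the vertices of `l` are passed. -/
def passAll (c : Fin 2) (l : List (Fin n)) (σ : Fin n → Fin 2) : ℝ :=
  (l.map fun u => M.pass c (σ u)).prod

/-- The conditions on a model under which the sampler is analysed. -/
structure Good : Prop where
  nodup : ∀ v, (M.adj v).Nodup
  length_le : ∀ v, (M.adj v).length ≤ M.Δ
  not_mem : ∀ v, v ∉ M.adj v
  one_le : 1 ≤ M.Δ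
  lam_nonneg : ∀ v c, 0 ≤ M.lam v c
  lam_pos : ∀ v, ∃ c, 0 < M.lam v c
  β_pos : 0 < M.β
  le_slack : 1 - 1 / (2 * M.Δ) ≤ M.slack
  w_nonneg : ∀ σ, 0 ≤ M.w σ
  w_pos : ∀ σ, (∀ v, 0 < M.lam v (σ v)) → 0 < M.w σ
  balance : ∀ v σ c b, M.w (Function.update σ v c) * (M.lam v b * M.passAll b (M.adj v) σ) =
    M.w (Function.update σ v b) * (M.lam v c * M.passAll c (M.adj v) σ)

/-- The partial configuration `g` has positive weight at each pinned vertex. -/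
def Valid (g : ℕ → ℝ) : Prop :=
  ∀ u : Fin n, (0 < g u → 0 < M.lam u 1) ∧ (g u < 0 → 0 < M.lam u 0)

variable {M}

theorem Good.slack_pos (hM : M.Good) : 0 < M.slack := by
  have h := hM.le_slack
  have h1 : (1 : ℝ) ≤ M.Δ := by exact_mod_cast hM.one_le
  have : 1 / (2 * (M.Δ : ℝ)) ≤ 1 / 2 := by
    apply one_div_le_one_div_of_le <;> linarith
  linarith

theorem Good.slack_le_one (hM : M.Good) : M.slack ≤ 1 := by
  have := hM.β_pos
  unfold slack; split_ifs with h
  · exact h.le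
  · rw [div_le_one this]; linarith

theorem Good.pass_pos (hM : M.Good) (c b : Fin 2) : 0 < M.pass c b := by
  have := hM.slack_pos
  have := hM.slack_le_one
  unfold pass; split_ifs <;> linarith

theorem Good.pass_le_one (hM : M.Good) (c b : Fin 2) : M.pass c b ≤ 1 := by
  have := hM.slack_pos
  have := hM.slack_le_one
  unfold pass; split_ifs <;> linarith

theorem Good.passAll_pos (hM : M.Good) (c : Fin 2) (l : List (Fin n)) (σ : Fin n → Fin 2) :
    0 < M.passAll c l σ := by
  refine List.prod_pos fun x hx => ?_
  obtain ⟨u, -, rfl⟩ := List.mem_map.1 hx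
  exact hM.pass_pos _ _

theorem Good.passAll_le_one (hM : M.Good) (c : Fin 2) (l : List (Fin n)) (σ : Fin n → Fin 2) :
    M.passAll c l σ ≤ 1 := by
  induction l with
  | nil => simp [passAll]
  | cons u l ih =>
    have h : M.passAll c (u :: l) σ = M.pass c (σ u) * M.passAll c l σ := by simp [passAll]
    rw [h]
    exact mul_le_one₀ (hM.pass_le_one _ _) (hM.passAll_pos _ _ _).le ih

theorem passAll_cons (c : Fin 2) (u : Fin n) (l : List (Fin n)) (σ : Fin n → Fin 2) :
    M.passAll c (u :: l) σ = M.pass c (σ u) * M.passAll c l σ := by simp [passAll]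

theorem Good.sum_lam_pos (hM : M.Good) (v : Fin n) : 0 < M.lam v 0 + M.lam v 1 := by
  obtain ⟨c, hc⟩ := hM.lam_pos v
  have h0 := hM.lam_nonneg v 0
  have h1 := hM.lam_nonneg v 1
  fin_cases c
  · simp at hc; linarith
  · simp at hc; linarith

/-- Zero fields could make the conditioning void. A valid pinning extends to a configuration with
positive field at every vertex, by giving each free vertex some spin of positive field. -/
theorem Good.sum_pinned_pos (hM : M.Good) {g : ℕ → ℝ} (hg : M.Valid g) :
    0 < ∑ σ, pinned M.w g σ := by
  choose d hd using hM.lam_pos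
  let σ : Fin n → Fin 2 := fun u => if 0 < g u then 1 else if g u < 0 then 0 else d u
  have hσ : Agrees g σ := by
    intro u
    refine ⟨fun h => by simp [σ, h], fun h => by simp [σ, h, h.le]⟩
  have hw : 0 < M.w σ := by
    refine hM.w_pos σ fun v => ?_
    simp only [σ]
    split_ifs with h1 h2
    exacts [(hg v).1 h1, (hg v).2 h2, hd v]
  refine Finset.sum_pos' (fun σ _ => pinned_nonneg hM.w_nonneg g σ) ⟨σ, Finset.mem_univ σ, ?_⟩
  rwa [pinned, if_pos hσ]

theorem Valid.update {g : ℕ → ℝ} (hg : M.Valid g) {u : Fin n} {b : Fin 2} (hb : 0 < M.lam u b)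
    {D : ℝ} (hD : 0 < D) : M.Valid (Function.update g u (pin D b)) := by
  intro x
  by_cases hx : x = u
  · subst hx
    rw [Function.update_self, pin_pos_iff hD, pin_neg_iff hD]
    exact ⟨fun h => h ▸ hb, fun h => h ▸ hb⟩
  · rw [Function.update_of_ne (by simpa [Fin.ext_iff] using hx)]
    exact hg x

/-- The weight of spin `c` at `v` given its neighbours, up to a factor. -/
def localWeight (M : Model n) (v : Fin n) (c : Fin 2) (σ : Fin n → Fin 2) : ℝ :=
  M.lam v c * M.passAll c (M.adj v) σ

/-- The expectation of `B` at the spin of `v` given its neighbours. -/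
def localMean (M : Model n) (v : Fin n) (B : Fin 2 → ℝ) (σ : Fin n → Fin 2) : ℝ :=
  (∑ c, M.localWeight v c σ * B c) / ∑ c, M.localWeight v c σ

/-- The expected value of a round of the rejection loop at `v` with proposal `c`, when the edges to
the vertices of `l` are still to be examined. -/
def roundMean (M : Model n) (v : Fin n) (B : Fin 2 → ℝ) (c : Fin 2) (l : List (Fin n))
    (σ : Fin n → Fin 2) : ℝ :=
  M.passAll c l σ * B c + (1 - M.passAll c l σ) * M.localMean v B σ

open Classical in
/-- The expected value when the edge to `u` has imposed its constraint. -/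
def checkMean (M : Model n) (v : Fin n) (B : Fin 2 → ℝ) (c : Fin 2) (u : Fin n) (l : List (Fin n))
    (σ : Fin n → Fin 2) : ℝ :=
  if M.Accepts c (σ u) then M.roundMean v B c l σ else M.localMean v B σ

theorem Good.localWeight_nonneg (hM : M.Good) (v : Fin n) (c : Fin 2) (σ : Fin n → Fin 2) :
    0 ≤ M.localWeight v c σ :=
  mul_nonneg (hM.lam_nonneg v c) (hM.passAll_pos c _ σ).le

theorem Good.sum_localWeight_pos (hM : M.Good) (v : Fin n) (σ : Fin n → Fin 2) :
    0 < ∑ c, M.localWeight v c σ := by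
  obtain ⟨c, hc⟩ := hM.lam_pos v
  exact Finset.sum_pos' (fun c _ => hM.localWeight_nonneg v c σ)
    ⟨c, Finset.mem_univ c, mul_pos hc (hM.passAll_pos c _ σ)⟩

theorem Good.localMean_nonneg (hM : M.Good) (v : Fin n) {B : Fin 2 → ℝ} (hB : ∀ c, 0 ≤ B c)
    (σ : Fin n → Fin 2) : 0 ≤ M.localMean v B σ :=
  div_nonneg (Finset.sum_nonneg fun c _ => mul_nonneg (hM.localWeight_nonneg v c σ) (hB c))
    (hM.sum_localWeight_pos v σ).le

theorem Good.roundMean_nonneg (hM : M.Good) (v : Fin n) {B : Fin 2 → ℝ} (hB : ∀ c, 0 ≤ B c)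
    (c : Fin 2) (l : List (Fin n)) (σ : Fin n → Fin 2) : 0 ≤ M.roundMean v B c l σ := by
  have h1 := hM.passAll_pos c l σ
  have h2 := hM.passAll_le_one c l σ
  have h3 := hM.localMean_nonneg v hB σ
  exact add_nonneg (mul_nonneg h1.le (hB c)) (mul_nonneg (by linarith) h3)

theorem Good.checkMean_nonneg (hM : M.Good) (v : Fin n) {B : Fin 2 → ℝ} (hB : ∀ c, 0 ≤ B c)
    (c : Fin 2) (u : Fin n) (l : List (Fin n)) (σ : Fin n → Fin 2) :
    0 ≤ M.checkMean v B c u l σ := by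
  unfold checkMean; split_ifs
  exacts [hM.roundMean_nonneg v hB c l σ, hM.localMean_nonneg v hB σ]

/-- Conditioning on the coin of the first edge. -/
theorem roundMean_cons (v : Fin n) (B : Fin 2 → ℝ) (c : Fin 2) (u : Fin n) (l : List (Fin n))
    (σ : Fin n → Fin 2) :
    M.roundMean v B c (u :: l) σ =
      M.slack * M.roundMean v B c l σ + (1 - M.slack) * M.checkMean v B c u l σ := by
  unfold checkMean roundMean
  rw [passAll_cons, pass]
  split_ifs <;> ring

/-- One step of the rejection loop. -/
theorem Good.localMean_eq (hM : M.Good) (v : Fin n) (B : Fin 2 → ℝ) (σ : Fin n → Fin 2) :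
    M.lam v 0 / (M.lam v 0 + M.lam v 1) * M.roundMean v B 0 (M.adj v) σ +
      (1 - M.lam v 0 / (M.lam v 0 + M.lam v 1)) * M.roundMean v B 1 (M.adj v) σ =
      M.localMean v B σ := by
  have h := hM.sum_lam_pos v
  have hm := hM.sum_localWeight_pos v σ
  -- The local mean is the fixed point of "accept or restart"; cleared of denominators, the claim is
  -- its defining equation.
  have e : M.localMean v B σ * (∑ c, M.localWeight v c σ) = ∑ c, M.localWeight v c σ * B c := by
    unfold localMean; field_simp
  simp only [Fin.sum_univ_two, localWeight] at e
  unfold roundMean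
  have e1 : 1 - M.lam v 0 / (M.lam v 0 + M.lam v 1) = M.lam v 1 / (M.lam v 0 + M.lam v 1) := by
    field_simp; ring
  rw [e1]
  have : M.lam v 0 + M.lam v 1 ≠ 0 := h.ne'
  field_simp
  linear_combination -e

theorem passAll_update {v : Fin n} {l : List (Fin n)} (hv : v ∉ l) (c b : Fin 2)
    (σ : Fin n → Fin 2) : M.passAll c l (Function.update σ v b) = M.passAll c l σ := by
  unfold passAll
  congr 1
  refine List.map_congr_left fun u hu => ?_
  rw [Function.update_of_ne (ne_of_mem_of_not_mem hu hv)]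

theorem Good.condExp_localMean (hM : M.Good) {g : ℕ → ℝ} {v : Fin n} (hv : g v = 0)
    (B : Fin 2 → ℝ) :
    condExp M.w g (M.localMean v B) = condExp M.w g (fun σ => B (σ v)) :=
  condExp_resample hv (M.localWeight v) (fun σ => (hM.sum_localWeight_pos v σ).ne')
    (fun σ c b => by simp only [localWeight, passAll_update (hM.not_mem v)]) (hM.balance v) B

end Model

end LocalSampler

namespace RAM

/-! ### Measurability of the machine -/

instance : MeasurableSpace (Option ℕ) := ⊤

/-- The components of a machine configuration. -/
def State.components (s : State) :
    ℕ × (ℕ → ℕ) × (ℕ → ℝ) × (ℕ → ℕ) × (ℕ → ℝ) × (ℕ → Option ℕ) :=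
  (s.pc, s.reg, s.rreg, s.mem, s.rmem, s.out)

instance : MeasurableSpace State := MeasurableSpace.comap State.components inferInstance

theorem measurable_components : Measurable State.components := comap_measurable _

theorem measurable_pc : Measurable State.pc := measurable_components.fst
theorem measurable_reg : Measurable State.reg := measurable_components.snd.fst
theorem measurable_rreg : Measurable State.rreg := measurable_components.snd.snd.fst
theorem measurable_mem : Measurable State.mem := measurable_components.snd.snd.snd.fst
theorem measurable_rmem : Measurable State.rmem := measurable_components.snd.snd.snd.snd.fst
theorem measurable_out : Measurable State.out := measurable_components.snd.snd.snd.snd.snd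

section

variable {α : Type*} [MeasurableSpace α]

theorem measurable_state {p : α → ℕ} {r : α → ℕ → ℕ} {x : α → ℕ → ℝ} {m : α → ℕ → ℕ}
    {y : α → ℕ → ℝ} {o : α → ℕ → Option ℕ} (hp : Measurable p) (hr : Measurable r)
    (hx : Measurable x) (hm : Measurable m) (hy : Measurable y) (ho : Measurable o) :
    Measurable fun a => (⟨p a, r a, x a, m a, y a, o a⟩ : State) :=
  measurable_comap_iff.2 (hp.prodMk (hr.prodMk (hx.prodMk (hm.prodMk (hy.prodMk ho)))))

/-- Addresses are countable, so joint measurability reduces to one fixed address at a time. -/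
theorem measurable_apply_index {β : Type*} [MeasurableSpace β] {f : α → ℕ → β} {i : α → ℕ}
    (hf : Measurable f) (hi : Measurable i) : Measurable fun a => f a (i a) := by
  have h : Measurable fun p : (ℕ → β) × ℕ => p.1 p.2 :=
    measurable_from_prod_countable_left fun k => measurable_pi_apply k
  exact h.comp (hf.prodMk hi)

theorem measurable_update_index {β : Type*} [MeasurableSpace β] {f : α → ℕ → β} {i : α → ℕ}
    {x : α → β} (hf : Measurable f) (hi : Measurable i) (hx : Measurable x) :
    Measurable fun a => Function.update (f a) (i a) (x a) := by
  refine measurable_pi_iff.2 fun j => ?_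
  simp only [Function.update_apply]
  exact Measurable.ite (measurableSet_eq_fun measurable_const hi) hx
    ((measurable_pi_apply j).comp hf)

theorem measurable_of_nat_two {β : Type*} [MeasurableSpace β] (h : ℕ → ℕ → β) {i j : α → ℕ}
    (hi : Measurable i) (hj : Measurable j) : Measurable fun a => h (i a) (j a) :=
  (Measurable.of_discrete (f := fun p : ℕ × ℕ => h p.1 p.2)).comp (hi.prodMk hj)

variable {f : α → State} (hf : Measurable f)
include hf

theorem measurable_reg_apply (i : ℕ) : Measurable fun a => (f a).reg i :=
  (measurable_pi_apply i).comp (measurable_reg.comp hf)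

theorem measurable_rreg_apply (i : ℕ) : Measurable fun a => (f a).rreg i :=
  (measurable_pi_apply i).comp (measurable_rreg.comp hf)

theorem measurable_next_pc : Measurable fun a => (f a).pc + 1 :=
  (measurable_pc.comp hf).add_const 1

theorem measurable_setReg (i : ℕ) {x : α → ℕ} (hx : Measurable x) :
    Measurable fun a => (f a).setReg i (x a) :=
  measurable_state (measurable_next_pc hf)
    (measurable_update_index (measurable_reg.comp hf) measurable_const hx)
    (measurable_rreg.comp hf) (measurable_mem.comp hf) (measurable_rmem.comp hf)
    (measurable_out.comp hf)

theorem measurable_setReal (i : ℕ) {x : α → ℝ} (hx : Measurable x) :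
    Measurable fun a => (f a).setReal i (x a) :=
  measurable_state (measurable_next_pc hf) (measurable_reg.comp hf)
    (measurable_update_index (measurable_rreg.comp hf) measurable_const hx)
    (measurable_mem.comp hf) (measurable_rmem.comp hf) (measurable_out.comp hf)

theorem measurable_branch {p : α → Prop} [∀ a, Decidable (p a)] (hp : MeasurableSet {a | p a})
    (l : ℕ) : Measurable fun a => (f a).branch (p a) l :=
  measurable_state (Measurable.ite hp measurable_const (measurable_next_pc hf))
    (measurable_reg.comp hf) (measurable_rreg.comp hf) (measurable_mem.comp hf)
    (measurable_rmem.comp hf) (measurable_out.comp hf)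

theorem measurable_exec (I : Input) {u : α → unitInterval} (hu : Measurable u) (ins : Instr) :
    Measurable fun a => exec I (u a) (f a) ins := by
  have hr := measurable_reg_apply hf
  have hx := measurable_rreg_apply hf
  cases ins with
  | const i m => exact measurable_setReg hf i measurable_const
  | add i j k => exact measurable_setReg hf i ((hr j).add (hr k))
  | sub i j k => exact measurable_setReg hf i ((hr j).sub (hr k))
  | load i j => exact measurable_setReg hf i (measurable_apply_index (measurable_mem.comp hf) (hr j))
  | store i j =>
    exact measurable_state (measurable_next_pc hf) (measurable_reg.comp hf)
      (measurable_rreg.comp hf) (measurable_update_index (measurable_mem.comp hf) (hr i) (hr j))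
      (measurable_rmem.comp hf) (measurable_out.comp hf)
  | jump l => exact measurable_branch hf (MeasurableSet.const True) l
  | jumpLt i j l => exact measurable_branch hf (measurableSet_lt (hr i) (hr j)) l
  | rconst a x => exact measurable_setReal hf a measurable_const
  | radd a b c => exact measurable_setReal hf a ((hx b).add (hx c))
  | rsub a b c => exact measurable_setReal hf a ((hx b).sub (hx c))
  | rmul a b c => exact measurable_setReal hf a ((hx b).mul (hx c))
  | rdiv a b c => exact measurable_setReal hf a ((hx b).div (hx c))
  | rload a j =>
    exact measurable_setReal hf a (measurable_apply_index (measurable_rmem.comp hf) (hr j))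
  | rstore i b =>
    exact measurable_state (measurable_next_pc hf) (measurable_reg.comp hf)
      (measurable_rreg.comp hf) (measurable_mem.comp hf)
      (measurable_update_index (measurable_rmem.comp hf) (hr i) (hx b)) (measurable_out.comp hf)
  | rjumpLt a b l => exact measurable_branch hf (measurableSet_lt (hx a) (hx b)) l
  | rand a => exact measurable_setReal hf a (measurable_subtype_coe.comp hu)
  | getSize i => exact measurable_setReg hf i measurable_const
  | getDegree i j => exact measurable_setReg hf i ((Measurable.of_discrete (f := I.degree)).comp (hr j))
  | getNeighbor i j k =>
    exact measurable_setReg hf i (measurable_of_nat_two I.neighbor (hr j) (hr k))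
  | getField a j k =>
    exact measurable_setReal hf a (measurable_of_nat_two I.fieldAt (hr j) (hr k))
  | getActivity a => exact measurable_setReal hf a measurable_const
  | getQuerySize i => exact measurable_setReg hf i measurable_const
  | getQuery i j => exact measurable_setReg hf i ((Measurable.of_discrete (f := I.queryAt)).comp (hr j))
  | output i j =>
    exact measurable_state (measurable_next_pc hf) (measurable_reg.comp hf)
      (measurable_rreg.comp hf) (measurable_mem.comp hf) (measurable_rmem.comp hf)
      (measurable_update_index (measurable_out.comp hf) (hr i)
        ((Measurable.of_discrete (f := (some : ℕ → Option ℕ))).comp (hr j)))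

end

theorem measurable_step (P : Program) (I : Input) :
    Measurable fun q : State × unitInterval => step P I q.2 q.1 := by
  -- The program counter is split off as a separate countable coordinate: on each slice the
  -- instruction is fixed.
  have h : Measurable fun q : (State × unitInterval) × ℕ =>
      match P[q.2]? with
      | none => q.1.1
      | some ins => exec I q.1.2 q.1.1 ins := by
    refine measurable_from_prod_countable_left fun m => ?_
    dsimp only
    cases P[m]? with
    | none => exact measurable_fst
    | some ins => exact measurable_exec measurable_fst I measurable_snd ins
  exact h.comp (measurable_id.prodMk (measurable_pc.comp measurable_fst))

theorem measurable_run (P : Program) (I : Input) (t : ℕ) : Measurable fun ω => run P I ω t := by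
  induction t with
  | zero => exact measurable_const
  | succ t ih => exact (measurable_step P I).comp (ih.prodMk (measurable_pi_apply t))

theorem measurableSet_halted (P : Program) : MeasurableSet {s | Halted P s} :=
  measurableSet_le measurable_const measurable_pc

theorem run_congr (P : Program) (I : Input) {ω ω' : ℕ → unitInterval} {t : ℕ}
    (h : ∀ i < t, ω i = ω' i) : run P I ω t = run P I ω' t := by
  induction t with
  | zero => rfl
  | succ t ih =>
    rw [run, run, ih fun i hi => h i (hi.trans t.lt_succ_self), h t t.lt_succ_self]

instance : IsProbabilityMeasure tapeMeasure := by unfold tapeMeasure; infer_instance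

/-- The state after t steps is a function of the coordinates below t only. -/
theorem indepFun_run (P : Program) (I : Input) (t : ℕ) :
    ProbabilityTheory.IndepFun (fun ω => run P I ω t) (fun ω => ω t) tapeMeasure := by
  have h := (ProbabilityTheory.iIndepFun_infinitePi (P := fun _ : ℕ => (volume : Measure unitInterval))
    (X := fun _ x => x) fun _ => measurable_id).indepFun_finset (Finset.range t) {t} (by simp)
    fun i => measurable_pi_apply i
  let φ : (Finset.range t → unitInterval) → State := fun x =>
    run P I (fun i => if hi : i ∈ Finset.range t then x ⟨i, hi⟩ else 0) t
  have hφ : Measurable φ := by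
    refine (measurable_run P I t).comp (measurable_pi_iff.2 fun i => ?_)
    by_cases hi : i ∈ Finset.range t
    · simpa [hi] using measurable_pi_apply _
    · simp [hi]
  have h2 := h.comp hφ (measurable_pi_apply (⟨t, Finset.mem_singleton_self t⟩ : ({t} : Finset ℕ)))
  refine ProbabilityTheory.IndepFun.congr h2 (.of_forall fun ω => ?_) .rfl
  refine (run_congr P I fun i hi => ?_).symm
  simp only [Finset.mem_range, hi, dite_true]

/-- The Markov property in integrated form: the random number of step t is independent of the state
on which it acts. -/
theorem lintegral_run_step (P : Program) (I : Input) (t : ℕ) {Φ : State → ℝ≥0∞}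
    (hΦ : Measurable Φ) :
    ∫⁻ ω, Φ (run P I ω (t + 1)) ∂tapeMeasure =
      ∫⁻ ω, ∫⁻ u : unitInterval, Φ (step P I u (run P I ω t)) ∂volume ∂tapeMeasure := by
  have hm := (hΦ.comp (measurable_step P I))
  have hr := measurable_run P I t
  have ht : Measurable fun ω : ℕ → unitInterval => ω t := measurable_pi_apply t
  have h := (ProbabilityTheory.indepFun_iff_map_prod_eq_prod_map_map hr.aemeasurable
    ht.aemeasurable).1 (indepFun_run P I t)
  have hv : Measure.map (fun ω : ℕ → unitInterval => ω t) tapeMeasure = volume :=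
    (measurePreserving_eval_infinitePi (fun _ => (volume : Measure unitInterval)) t).map_eq
  calc ∫⁻ ω, Φ (run P I ω (t + 1)) ∂tapeMeasure
      = ∫⁻ q, (Φ ∘ fun q : State × unitInterval => step P I q.2 q.1) q
          ∂(Measure.map (fun ω => (run P I ω t, ω t)) tapeMeasure) := by
        rw [lintegral_map hm (hr.prodMk ht)]; rfl
    _ = ∫⁻ s, ∫⁻ u, Φ (step P I u s) ∂volume ∂(Measure.map (fun ω => run P I ω t) tapeMeasure) := by
        have : SFinite (Measure.map (fun ω => run P I ω t) tapeMeasure) := inferInstance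
        rw [h, hv, lintegral_prod _ hm.aemeasurable]; rfl
    _ = _ := lintegral_map hm.lintegral_prod_right' hr

/-! ### Truncated expected costs -/

open Classical in
/-- The expectation of `κ` times the running time plus the value `F` of the final configuration,
for the computation that starts in `s` and is cut off, at value `0`, after `k` steps. -/
def value (P : Program) (I : Input) (κ : ℝ≥0∞) (F : State → ℝ≥0∞) : ℕ → State → ℝ≥0∞
  | 0, _ => 0
  | k + 1, s => if Halted P s then F s else κ + ∫⁻ u : unitInterval, value P I κ F k (step P I u s)

section

variable {P : Program} {I : Input} {κ : ℝ≥0∞} {F : State → ℝ≥0∞}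

theorem value_halted {s : State} (h : Halted P s) (k : ℕ) : value P I κ F (k + 1) s = F s :=
  if_pos h

theorem value_running {s : State} (h : ¬ Halted P s) (k : ℕ) :
    value P I κ F (k + 1) s = κ + ∫⁻ u : unitInterval, value P I κ F k (step P I u s) :=
  if_neg h

theorem value_le_succ (k : ℕ) (s : State) : value P I κ F k s ≤ value P I κ F (k + 1) s := by
  induction k generalizing s with
  | zero => exact zero_le
  | succ k ih =>
    by_cases h : Halted P s
    · rw [value_halted h, value_halted h]
    · rw [value_running h, value_running h]
      gcongr
      exact ih _

theorem measurable_value (hF : Measurable F) (k : ℕ) : Measurable (value P I κ F k) := by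
  classical
  induction k with
  | zero => exact measurable_const
  | succ k ih =>
    exact Measurable.ite (measurableSet_halted P) hF
      ((ih.comp (measurable_step P I)).lintegral_prod_right'.const_add κ)

theorem step_of_halted {s : State} (h : Halted P s) (u : unitInterval) : step P I u s = s := by
  unfold step
  rw [List.getElem?_eq_none h]

open Classical in
-- A single recursion for running and halted states. It needs `k + 2`: with one step less, a halted
-- state would have its reward cut off on the right-hand side.
theorem value_eq_add (k : ℕ) (s : State) :
    value P I κ F (k + 2) s =
      (if Halted P s then 0 else κ) + ∫⁻ u : unitInterval, value P I κ F (k + 1) (step P I u s) := by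
  by_cases h : Halted P s
  · simp [value_halted h, step_of_halted h, h]
  · rw [value_running h, if_neg h]

open Classical in
-- Unrolls `value` along the run. For F = 0 the first term gives the expected running time, for κ =
-- 0 the second gives a halting probability. The start t is arbitrary so that the induction can peel
-- off the first step.
theorem sum_add_le_lintegral_value (hF : Measurable F) (k t : ℕ) :
    (∑ i ∈ Finset.range k, ∫⁻ ω, (if Halted P (run P I ω (t + i)) then 0 else κ) ∂tapeMeasure) +
      ∫⁻ ω, (if Halted P (run P I ω (t + k)) then F (run P I ω (t + k)) else 0) ∂tapeMeasure ≤
      ∫⁻ ω, value P I κ F (k + 1) (run P I ω t) ∂tapeMeasure := by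
  induction k generalizing t with
  | zero =>
    simp only [Finset.range_zero, Finset.sum_empty, zero_add, add_zero]
    refine lintegral_mono fun ω => ?_
    split_ifs with h
    · rw [value_halted h]
    · exact zero_le
  | succ k ih =>
    have hm : Measurable fun ω => if Halted P (run P I ω t) then 0 else κ :=
      Measurable.ite ((measurable_run P I t) (measurableSet_halted P)) measurable_const
        measurable_const
    simp only [value_eq_add]
    rw [lintegral_add_left hm, ← lintegral_run_step P I t (measurable_value hF (k + 1)),
      Finset.sum_range_succ', add_zero]
    have := ih (t + 1)
    simp only [add_assoc, add_comm 1] at this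
    rw [add_right_comm, add_comm]
    gcongr

theorem halted_mono {ω : ℕ → unitInterval} {t t' : ℕ} (h : Halted P (run P I ω t)) (ht : t ≤ t') :
    run P I ω t' = run P I ω t := by
  induction t', ht using Nat.le_induction with
  | base => rfl
  | succ m _ ih => rw [run, ih, step_of_halted h]

theorem lintegral_value_init (k : ℕ) :
    ∫⁻ ω, value P I κ F k (run P I ω 0) ∂tapeMeasure = value P I κ F k State.init := by
  simp [run]

theorem runtime_eq_iSup (ω : ℕ → unitInterval) :
    runtime P I ω = ⨆ k, ∑ i ∈ Finset.range k,
      (open Classical in if Halted P (run P I ω i) then (0 : ℝ≥0∞) else 1) := by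
  classical
  have hsum : ∀ k, (∀ i < k, ¬ Halted P (run P I ω i)) →
      ∑ i ∈ Finset.range k, (if Halted P (run P I ω i) then (0 : ℝ≥0∞) else 1) = k := by
    intro k hk
    rw [Finset.sum_congr rfl fun i hi => if_neg (hk i (Finset.mem_range.1 hi))]
    simp
  unfold runtime
  by_cases h : ∃ t, Halted P (run P I ω t)
  · have hlt : ∀ i < Nat.find h, ¬ Halted P (run P I ω i) := fun i hi => Nat.find_min h hi
    have hge : ∀ i, Nat.find h ≤ i → Halted P (run P I ω i) := fun i hi => by
      rw [halted_mono (Nat.find_spec h) hi]; exact Nat.find_spec h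
    apply le_antisymm
    · refine (iInf₂_le (Nat.find h) (Nat.find_spec h)).trans ?_
      rw [← hsum _ hlt]
      exact le_iSup (fun k => ∑ i ∈ Finset.range k,
        (if Halted P (run P I ω i) then (0 : ℝ≥0∞) else 1)) _
    · refine le_iInf₂ fun t ht => iSup_le fun k => ?_
      have h1 : ∑ i ∈ Finset.range k, (if Halted P (run P I ω i) then (0 : ℝ≥0∞) else 1) ≤
          ∑ i ∈ Finset.range t, 1 := by
        rcases le_total k t with hkt | hkt
        · refine (Finset.sum_le_sum fun i _ => ?_).trans
            (Finset.sum_le_sum_of_subset (Finset.range_mono hkt))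
          split_ifs <;> simp
        · rw [← Finset.sum_subset (Finset.range_mono hkt)]
          · refine Finset.sum_le_sum fun i _ => ?_
            split_ifs <;> simp
          · intro i _ hi
            rw [if_pos]
            rw [halted_mono ht (by simpa using hi)]
            exact ht
      simpa using h1
  · push Not at h
    have : ∀ k, ∑ i ∈ Finset.range k, (if Halted P (run P I ω i) then (0 : ℝ≥0∞) else 1) = k :=
      fun k => hsum k fun i _ => h i
    simp only [this, ENNReal.iSup_natCast, iInf_eq_top]
    exact fun t ht => absurd ht (h t)

theorem lintegral_runtime_le {b : ℝ≥0∞} (h : ∀ k, value P I 1 0 k State.init ≤ b) :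
    ∫⁻ ω, runtime P I ω ∂tapeMeasure ≤ b := by
  classical
  simp only [runtime_eq_iSup]
  have hm : ∀ i, Measurable fun ω => if Halted P (run P I ω i) then (0 : ℝ≥0∞) else 1 := fun i =>
    Measurable.ite ((measurable_run P I i) (measurableSet_halted P)) measurable_const
      measurable_const
  rw [lintegral_iSup (fun k => Finset.measurable_fun_sum _ fun i _ => hm i)]
  · refine iSup_le fun k => ?_
    rw [lintegral_finsetSum _ fun i _ => hm i]
    have := sum_add_le_lintegral_value (P := P) (I := I) (κ := 1) (F := 0) measurable_const k 0
    simp only [zero_add, lintegral_value_init] at this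
    exact (le_self_add).trans (this.trans (h _))
  · intro k k' hk ω
    exact Finset.sum_le_sum_of_subset (Finset.range_mono hk)

theorem ae_halted {b : ℝ≥0∞} (hb : b ≠ ⊤) (h : ∀ k, value P I 1 0 k State.init ≤ b) :
    ∀ᵐ ω ∂tapeMeasure, ∃ t, Halted P (run P I ω t) := by
  classical
  have hm : Measurable fun ω => runtime P I ω := by
    simp only [runtime_eq_iSup]
    exact Measurable.iSup fun k => Finset.measurable_fun_sum _ fun i _ =>
      Measurable.ite ((measurable_run P I i) (measurableSet_halted P)) measurable_const
        measurable_const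
  filter_upwards [ae_lt_top hm (ne_top_of_le_ne_top hb (lintegral_runtime_le h))] with ω hω
  by_contra hc
  push Not at hc
  refine hω.ne ?_
  simp only [runtime, iInf_eq_top]
  exact fun t ht => absurd ht (hc t)

/-- The probability to halt in a set of configurations. -/
theorem measure_halted_in_le {S : Set State} (hS : MeasurableSet S) {b : ℝ≥0∞}
    (h : ∀ k, value P I 0 (S.indicator 1) k State.init ≤ b) :
    tapeMeasure {ω | ∃ t, Halted P (run P I ω t) ∧ run P I ω t ∈ S} ≤ b := by
  classical
  have hunion : {ω | ∃ t, Halted P (run P I ω t) ∧ run P I ω t ∈ S} =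
      ⋃ t, {ω | Halted P (run P I ω t) ∧ run P I ω t ∈ S} := by
    ext ω; simp
  have hmono : Monotone fun t => {ω | Halted P (run P I ω t) ∧ run P I ω t ∈ S} := by
    intro t t' ht ω hω
    change Halted P (run P I ω t') ∧ run P I ω t' ∈ S
    rw [halted_mono hω.1 ht]
    exact hω
  rw [hunion, hmono.measure_iUnion]
  refine iSup_le fun t => ?_
  have hms : MeasurableSet {ω | Halted P (run P I ω t) ∧ run P I ω t ∈ S} :=
    (measurable_run P I t) ((measurableSet_halted P).inter hS)
  rw [← lintegral_indicator_one hms]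
  have := sum_add_le_lintegral_value (P := P) (I := I) (κ := 0) (F := S.indicator 1)
    (measurable_one.indicator hS) t 0
  simp only [zero_add, lintegral_value_init] at this
  refine le_trans (lintegral_mono fun ω => ?_) ((le_add_self).trans (this.trans (h _)))
  simp only [Set.indicator_apply, Set.mem_ofPred_eq, Pi.one_apply]
  split_ifs <;> simp_all

end

/-! ### Rules for bounding `value` along deterministic stretches and at random draws -/

/-- The instruction does not use the random number. -/
def Instr.deterministic : Instr → Bool
  | .rand _ => false
  | _ => true

theorem exec_of_deterministic (I : Input) (s : State) {ins : Instr} (h : ins.deterministic = true)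
    (u u' : unitInterval) : exec I u s ins = exec I u' s ins := by
  cases ins <;> first | rfl | cases h

/-- From `s` the program passes in `m` deterministic steps to a configuration that satisfies `Q`. -/
def Steps (P : Program) (I : Input) (Q : State → Prop) : ℕ → State → Prop
  | 0, s => Q s
  | m + 1, s => ∃ ins, P[s.pc]? = some ins ∧ ins.deterministic = true ∧
      Steps P I Q m (exec I 0 s ins)

section

variable {P : Program} {I : Input} {κ : ℝ} {F : State → ℝ≥0∞}

theorem value_succ_eq_of_fetch {s : State} {ins : Instr} (h : P[s.pc]? = some ins) (k : ℕ)
    (κ : ℝ≥0∞) :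
    value P I κ F (k + 1) s = κ + ∫⁻ u : unitInterval, value P I κ F k (exec I u s ins) := by
  have hs : ¬ Halted P s := by
    intro hh
    rw [List.getElem?_eq_none hh] at h
    cases h
  rw [value_running hs]
  simp only [step, h]

/-- The cut-off k is the same before and after the stretch, by monotonicity of `value` in k.
Deterministic blocks therefore cost time but use up no induction parameter. -/
theorem Steps.value_le {Q : State → Prop} {m : ℕ} {s : State} (h : Steps P I Q m s) {k : ℕ}
    (hκ : 0 ≤ κ) {x y : ℝ} (hx : 0 ≤ x) (hy : κ * m + x ≤ y)
    (hQ : ∀ s', Q s' → value P I (.ofReal κ) F k s' ≤ .ofReal x) :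
    value P I (.ofReal κ) F k s ≤ .ofReal y := by
  induction m generalizing s y with
  | zero =>
    refine (hQ s h).trans (ENNReal.ofReal_le_ofReal ?_)
    simpa using hy
  | succ m ih =>
    obtain ⟨ins, h1, h2, h3⟩ := h
    refine (value_le_succ k s).trans ?_
    rw [value_succ_eq_of_fetch h1]
    have h4 : ∀ u, exec I u s ins = exec I 0 s ins := fun u => exec_of_deterministic I s h2 u 0
    simp only [h4, lintegral_const, measure_univ, mul_one]
    have h5 := ih h3 le_rfl
    have hm : 0 ≤ κ * m := mul_nonneg hκ (Nat.cast_nonneg m)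
    calc ENNReal.ofReal κ + value P I (.ofReal κ) F k (exec I 0 s ins)
        ≤ ENNReal.ofReal κ + ENNReal.ofReal (κ * m + x) := by gcongr
      _ = ENNReal.ofReal (κ + (κ * m + x)) := (ENNReal.ofReal_add hκ (by linarith)).symm
      _ ≤ ENNReal.ofReal y := by
        refine ENNReal.ofReal_le_ofReal ?_
        push_cast at hy
        linarith

theorem Steps.next {Q : State → Prop} {m : ℕ} {s : State} {ins : Instr} (hi : P[s.pc]? = some ins)
    (hd : ins.deterministic = true) (h : Steps P I Q m (exec I 0 s ins)) : Steps P I Q (m + 1) s :=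
  ⟨ins, hi, hd, h⟩

theorem Steps.jumpLt_pos {Q : State → Prop} {m i j l : ℕ} {s : State}
    (hi : P[s.pc]? = some (.jumpLt i j l)) (hlt : s.reg i < s.reg j)
    (h : Steps P I Q m { s with pc := l }) : Steps P I Q (m + 1) s :=
  ⟨_, hi, rfl, by simpa only [exec, State.branch, if_pos hlt] using h⟩

theorem Steps.jumpLt_neg {Q : State → Prop} {m i j l : ℕ} {s : State}
    (hi : P[s.pc]? = some (.jumpLt i j l)) (hlt : ¬ s.reg i < s.reg j)
    (h : Steps P I Q m { s with pc := s.pc + 1 }) : Steps P I Q (m + 1) s :=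
  ⟨_, hi, rfl, by simpa only [exec, State.branch, if_neg hlt] using h⟩

theorem Steps.rjumpLt_pos {Q : State → Prop} {m i j l : ℕ} {s : State}
    (hi : P[s.pc]? = some (.rjumpLt i j l)) (hlt : s.rreg i < s.rreg j)
    (h : Steps P I Q m { s with pc := l }) : Steps P I Q (m + 1) s :=
  ⟨_, hi, rfl, by simpa only [exec, State.branch, if_pos hlt] using h⟩

theorem Steps.rjumpLt_neg {Q : State → Prop} {m i j l : ℕ} {s : State}
    (hi : P[s.pc]? = some (.rjumpLt i j l)) (hlt : ¬ s.rreg i < s.rreg j)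
    (h : Steps P I Q m { s with pc := s.pc + 1 }) : Steps P I Q (m + 1) s :=
  ⟨_, hi, rfl, by simpa only [exec, State.branch, if_neg hlt] using h⟩

theorem Steps.jump {Q : State → Prop} {m l : ℕ} {s : State}
    (hi : P[s.pc]? = some (.jump l))
    (h : Steps P I Q m { s with pc := l }) : Steps P I Q (m + 1) s :=
  ⟨_, hi, rfl, by simpa only [exec, State.branch, if_true] using h⟩

/-- The endpoint 1 is a null set. Excluding it matters later: it is the only draw that could propose
a spin of zero field. -/
theorem lintegral_unitInterval_le {f : unitInterval → ℝ≥0∞} {q a b : ℝ} (hq : 0 ≤ q) (hq1 : q ≤ 1)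
    (ha : 0 ≤ a) (hb : 0 ≤ b) (h1 : ∀ u : unitInterval, (u : ℝ) < q → f u ≤ .ofReal a)
    (h2 : ∀ u : unitInterval, q ≤ u → (u : ℝ) < 1 → f u ≤ .ofReal b) :
    ∫⁻ u, f u ≤ .ofReal (q * a + (1 - q) * b) := by
  let p : unitInterval := ⟨q, hq, hq1⟩
  have hae : ∀ᵐ u : unitInterval, u ≠ 1 := by
    simp [ae_iff]
  calc ∫⁻ u, f u ≤ ∫⁻ u, ((Set.Iio p).indicator (fun _ => ENNReal.ofReal a) u +
        (Set.Ici p).indicator (fun _ => ENNReal.ofReal b) u) := by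
        refine lintegral_mono_ae ?_
        filter_upwards [hae] with u hu
        by_cases hup : (u : ℝ) < q
        · have m1 : u ∈ Set.Iio p := hup
          have m2 : u ∉ Set.Ici p := fun h : q ≤ u => absurd hup (not_lt.2 h)
          simpa [m1, m2] using h1 u hup
        · have m1 : u ∉ Set.Iio p := hup
          have m2 : u ∈ Set.Ici p := (not_lt.1 hup : q ≤ u)
          have : (u : ℝ) < 1 := lt_of_le_of_ne u.2.2 fun h => hu (Subtype.ext h)
          simpa [m1, m2] using h2 u (not_lt.1 hup) this
    _ = ENNReal.ofReal a * volume (Set.Iio p) + ENNReal.ofReal b * volume (Set.Ici p) := by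
        rw [lintegral_add_left (measurable_const.indicator measurableSet_Iio),
          lintegral_indicator_const measurableSet_Iio, lintegral_indicator_const measurableSet_Ici]
    _ = .ofReal (q * a + (1 - q) * b) := by
        rw [unitInterval.volume_Iio, unitInterval.volume_Ici,
          ENNReal.ofReal_add (mul_nonneg hq ha) (mul_nonneg (by linarith) hb),
          ENNReal.ofReal_mul hq, ENNReal.ofReal_mul (by linarith), mul_comm, mul_comm (ENNReal.ofReal b)]

/-- From `s` the program passes in at most `N` deterministic steps to a configuration that satisfies
`Q`. -/
def Reaches (P : Program) (I : Input) (N : ℕ) (s : State) (Q : State → Prop) : Prop :=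
  ∃ m ≤ N, Steps P I Q m s

theorem Reaches.value_le {Q : State → Prop} {N : ℕ} {s : State} (h : Reaches P I N s Q) {k : ℕ}
    (hκ : 0 ≤ κ) {x y : ℝ} (hx : 0 ≤ x) (hy : κ * N + x ≤ y)
    (hQ : ∀ s', Q s' → value P I (.ofReal κ) F k s' ≤ .ofReal x) :
    value P I (.ofReal κ) F k s ≤ .ofReal y := by
  obtain ⟨m, hm, h⟩ := h
  refine h.value_le hκ hx (le_trans ?_ hy) hQ
  gcongr

theorem value_succ_le_of_rand {s : State} {i : ℕ} (h : P[s.pc]? = some (.rand i)) {k : ℕ}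
    (hκ : 0 ≤ κ) {q a b y : ℝ} (hq : 0 ≤ q) (hq1 : q ≤ 1) (ha : 0 ≤ a) (hb : 0 ≤ b)
    (hy : κ + (q * a + (1 - q) * b) ≤ y)
    (h1 : ∀ u : ℝ, 0 ≤ u → u < q → value P I (.ofReal κ) F k (s.setReal i u) ≤ .ofReal a)
    (h2 : ∀ u : ℝ, q ≤ u → u < 1 → value P I (.ofReal κ) F k (s.setReal i u) ≤ .ofReal b) :
    value P I (.ofReal κ) F (k + 1) s ≤ .ofReal y := by
  rw [value_succ_eq_of_fetch h]
  have h3 := lintegral_unitInterval_le (f := fun u => value P I (.ofReal κ) F k (exec I u s (.rand i)))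
    hq hq1 ha hb (fun u => h1 u u.2.1) (fun u => h2 u)
  calc _ ≤ ENNReal.ofReal κ + .ofReal (q * a + (1 - q) * b) := by gcongr
    _ = .ofReal (κ + (q * a + (1 - q) * b)) :=
      (ENNReal.ofReal_add hκ (add_nonneg (mul_nonneg hq ha) (mul_nonneg (by linarith) hb))).symm
    _ ≤ _ := ENNReal.ofReal_le_ofReal hy

end

end RAM

/-! ### The program and its invariants -/

namespace LocalSampler

open RAM

/-- The sampler.

Registers for natural numbers: `0`, `1` hold these constants, `2` the current vertex, `3` an index
in its adjacency list, `4` the proposed spin, `5` the degree, `6` the height of the stack, `7` a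
neighbour, `8` the number of queries, `9` the number of answered queries. Registers for reals:
`0`, `1` hold these constants, `2` the slack of an edge, `3` the sign of the interaction, `4` the
level of recursion, `5`–`7` are temporary. The cell `u` of the real memory holds the pin of the
vertex `u`; the memory for natural numbers holds a stack of frames (vertex, index, spin). -/
def sampler : Program := [
  .const 1 1,
  .rconst 1 1,
  .getActivity 2,
  .rconst 3 1,
  .rconst 4 1,
  .rjumpLt 2 1 8,
  .rdiv 2 1 2,
  .jump 9,
  .rconst 3 (-1),
  -- 9: next query
  .getQuerySize 8,
  .jumpLt 9 8 12,
  .jump 75,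
  .getQuery 2 9,
  -- 13: sample the vertex in register 2
  .radd 4 4 1,
  .getDegree 5 2,
  -- 15: propose a spin
  .getField 5 2 0,
  .getField 6 2 1,
  .radd 6 5 6,
  .rand 7,
  .rmul 6 7 6,
  .const 4 0,
  .rjumpLt 6 5 23,
  .const 4 1,
  .const 3 0,
  -- 24: examine the next edge
  .jumpLt 3 5 26,
  .jump 47,
  .rand 7,
  .rjumpLt 7 2 45,
  .getNeighbor 7 2 3,
  .rload 5 7,
  .rjumpLt 5 0 40,
  .rjumpLt 0 5 40,
  -- 32: push a frame and sample the neighbour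
  .store 6 2,
  .add 6 6 1,
  .store 6 3,
  .add 6 6 1,
  .store 6 4,
  .add 6 6 1,
  .add 2 7 0,
  .jump 13,
  -- 40: compare the proposed spin with the pin in real register 5
  .rmul 5 3 5,
  .rjumpLt 5 0 44,
  .jumpLt 4 1 15,
  .jump 45,
  .jumpLt 0 4 15,
  .add 3 3 1,
  .jump 24,
  -- 47: the proposal is accepted; remove the pins of the current level
  .const 3 0,
  .rmul 6 4 4,
  .jumpLt 3 5 51,
  .jump 58,
  .getNeighbor 7 2 3,
  .rload 5 7,
  .rmul 5 5 5,
  .rjumpLt 5 6 56,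
  .rstore 7 0,
  .add 3 3 1,
  .jump 49,
  .rsub 4 4 1,
  -- 59: pin the vertex, then write the output or pop a frame
  .radd 5 4 0,
  .jumpLt 0 4 62,
  .rsub 5 0 4,
  .rstore 2 5,
  .jumpLt 0 6 67,
  .output 2 4,
  .add 9 9 1,
  .jump 9,
  .sub 6 6 1,
  .load 4 6,
  .sub 6 6 1,
  .load 3 6,
  .sub 6 6 1,
  .load 2 6,
  .getDegree 5 2,
  .jump 40]

/-- The sign of the interaction. -/
def Model.sign {n : ℕ} (M : Model n) : ℝ := if M.β < 1 then -1 else 1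

/-- The registers and memory cells that a call of the sampling routine leaves unchanged. -/
structure Base {n : ℕ} (M : Model n) (sp qi : ℕ) (mem : ℕ → ℕ) (out : ℕ → Option ℕ) (s : State) :
    Prop where
  zero : s.reg 0 = 0
  one : s.reg 1 = 1
  rzero : s.rreg 0 = 0
  rone : s.rreg 1 = 1
  slack : s.rreg 2 = M.slack
  sign : s.rreg 3 = M.sign
  height : s.reg 6 = sp
  index : s.reg 9 = qi
  stack : ∀ m < sp, s.mem m = mem m
  output : s.out = out

/-! ### Symbolic execution of the blocks of the program -/

section

variable {n : ℕ} {M : Model n}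

/-- The registers during the treatment of the vertex `v` at level `D` with pins `g`. -/
structure InLoop (M : Model n) (sp qi : ℕ) (mem : ℕ → ℕ) (out : ℕ → Option ℕ) (v : Fin n) (D : ℝ)
    (g : ℕ → ℝ) (s : State) : Prop extends Base M sp qi mem out s where
  vertex : s.reg 2 = v
  degree : s.reg 5 = (M.adj v).length
  level : s.rreg 4 = D
  pins : s.rmem = g

theorem input_degree (v : Fin n) : M.input.degree v = (M.adj v).length := by
  simp [Input.degree, Model.input]

theorem input_neighbor (v : Fin n) {i : ℕ} (h : i < (M.adj v).length) :
    M.input.neighbor v i = (M.adj v)[i] := by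
  simp [Input.neighbor, Model.input, h]

theorem input_field (v : Fin n) (c : Fin 2) : M.input.fieldAt v c = M.lam v c := by
  simp [Input.fieldAt, Model.input, c.2]

theorem input_field_zero (v : Fin n) : M.input.fieldAt v 0 = M.lam v 0 := input_field v 0

theorem input_field_one (v : Fin n) : M.input.fieldAt v 1 = M.lam v 1 := input_field v 1

variable {sp qi : ℕ} {mem : ℕ → ℕ} {out : ℕ → Option ℕ} {v : Fin n} {D : ℝ} {g : ℕ → ℝ} {s : State}

theorem reaches_enter (h : Base M sp qi mem out s) (hpc : s.pc = 13) (hv : s.reg 2 = v) :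
    Reaches sampler M.input 2 s fun s' =>
      InLoop M sp qi mem out v (s.rreg 4 + 1) s.rmem s' ∧ s'.pc = 15 := by
  obtain ⟨pc, reg, rreg, smem, rmem, sout⟩ := s
  obtain rfl : pc = 13 := hpc
  obtain ⟨h1, h2, h3, h4, h5, h6, h7, h8, h9, h10⟩ := h
  simp only at *
  refine ⟨2, le_rfl, ?_⟩
  iterate 2 refine .next rfl rfl ?_
  refine ⟨⟨⟨?_, ?_, ?_, ?_, ?_, ?_, ?_, ?_, h9, ?_⟩, ?_, ?_, ?_, ?_⟩, ?_⟩ <;>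
    simp [exec, State.setReg, State.setReal, input_degree, *]

theorem reaches_fields (h : InLoop M sp qi mem out v D g s) (hpc : s.pc = 15) :
    Reaches sampler M.input 3 s fun s' => InLoop M sp qi mem out v D g s' ∧ s'.pc = 18 ∧
      s'.rreg 5 = M.lam v 0 ∧ s'.rreg 6 = M.lam v 0 + M.lam v 1 := by
  obtain ⟨pc, reg, rreg, smem, rmem, sout⟩ := s
  obtain rfl : pc = 15 := hpc
  obtain ⟨⟨h1, h2, h3, h4, h5, h6, h7, h8, h9, h10⟩, h11, h12, h13, h14⟩ := h
  simp only at *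
  refine ⟨3, le_rfl, ?_⟩
  iterate 3 refine .next rfl rfl ?_
  refine ⟨⟨⟨?_, ?_, ?_, ?_, ?_, ?_, ?_, ?_, h9, ?_⟩, ?_, ?_, ?_, ?_⟩, ?_, ?_, ?_⟩ <;>
    simp [exec, State.setReal, input_field_zero, input_field_one, *]

theorem InLoop.setReal_seven (h : InLoop M sp qi mem out v D g s) (u : ℝ) :
    InLoop M sp qi mem out v D g (s.setReal 7 u) := by
  obtain ⟨⟨h1, h2, h3, h4, h5, h6, h7, h8, h9, h10⟩, h11, h12, h13, h14⟩ := h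
  refine ⟨⟨?_, ?_, ?_, ?_, ?_, ?_, ?_, ?_, h9, ?_⟩, ?_, ?_, ?_, ?_⟩ <;>
    simpa [State.setReal]

theorem reaches_propose_zero (h : InLoop M sp qi mem out v D g s) (hpc : s.pc = 19)
    (hlt : s.rreg 7 * s.rreg 6 < s.rreg 5) :
    Reaches sampler M.input 5 s fun s' => InLoop M sp qi mem out v D g s' ∧ s'.pc = 24 ∧
      s'.reg 3 = 0 ∧ s'.reg 4 = (0 : Fin 2) := by
  obtain ⟨pc, reg, rreg, smem, rmem, sout⟩ := s
  obtain rfl : pc = 19 := hpc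
  obtain ⟨⟨h1, h2, h3, h4, h5, h6, h7, h8, h9, h10⟩, h11, h12, h13, h14⟩ := h
  simp only at *
  refine ⟨4, by norm_num, ?_⟩
  iterate 2 refine .next rfl rfl ?_
  refine .rjumpLt_pos rfl (by simpa [exec, State.setReg, State.setReal] using hlt) ?_
  refine .next rfl rfl ?_
  refine ⟨⟨⟨?_, ?_, ?_, ?_, ?_, ?_, ?_, ?_, h9, ?_⟩, ?_, ?_, ?_, ?_⟩, ?_, ?_, ?_⟩ <;>
    simp [exec, State.setReg, State.setReal, *]

theorem reaches_propose_one (h : InLoop M sp qi mem out v D g s) (hpc : s.pc = 19)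
    (hlt : ¬ s.rreg 7 * s.rreg 6 < s.rreg 5) :
    Reaches sampler M.input 5 s fun s' => InLoop M sp qi mem out v D g s' ∧ s'.pc = 24 ∧
      s'.reg 3 = 0 ∧ s'.reg 4 = (1 : Fin 2) := by
  obtain ⟨pc, reg, rreg, smem, rmem, sout⟩ := s
  obtain rfl : pc = 19 := hpc
  obtain ⟨⟨h1, h2, h3, h4, h5, h6, h7, h8, h9, h10⟩, h11, h12, h13, h14⟩ := h
  simp only at *
  refine ⟨5, le_rfl, ?_⟩
  iterate 2 refine .next rfl rfl ?_
  refine .rjumpLt_neg rfl (by simpa [exec, State.setReg, State.setReal] using hlt) ?_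
  iterate 2 refine .next rfl rfl ?_
  refine ⟨⟨⟨?_, ?_, ?_, ?_, ?_, ?_, ?_, ?_, h9, ?_⟩, ?_, ?_, ?_, ?_⟩, ?_, ?_, ?_⟩ <;>
    simp [exec, State.setReg, State.setReal, *]

theorem reaches_coin (h : InLoop M sp qi mem out v D g s) (hpc : s.pc = 24)
    (hi : s.reg 3 < (M.adj v).length) :
    Reaches sampler M.input 1 s fun s' => InLoop M sp qi mem out v D g s' ∧ s'.pc = 26 ∧
      s'.reg 3 = s.reg 3 ∧ s'.reg 4 = s.reg 4 := by
  obtain ⟨pc, reg, rreg, smem, rmem, sout⟩ := s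
  obtain rfl : pc = 24 := hpc
  have h' := h
  obtain ⟨⟨h1, h2, h3, h4, h5, h6, h7, h8, h9, h10⟩, h11, h12, h13, h14⟩ := h'
  simp only at *
  refine ⟨1, le_rfl, ?_⟩
  refine .jumpLt_pos rfl (by simpa [h12] using hi) ?_
  exact ⟨⟨⟨h1, h2, h3, h4, h5, h6, h7, h8, h9, h10⟩, h11, h12, h13, h14⟩, rfl, rfl, rfl⟩

theorem reaches_accept (h : InLoop M sp qi mem out v D g s) (hpc : s.pc = 24)
    (hi : (M.adj v).length ≤ s.reg 3) :
    Reaches sampler M.input 2 s fun s' => InLoop M sp qi mem out v D g s' ∧ s'.pc = 47 ∧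
      s'.reg 4 = s.reg 4 := by
  obtain ⟨pc, reg, rreg, smem, rmem, sout⟩ := s
  obtain rfl : pc = 24 := hpc
  obtain ⟨⟨h1, h2, h3, h4, h5, h6, h7, h8, h9, h10⟩, h11, h12, h13, h14⟩ := h
  simp only at *
  refine ⟨2, le_rfl, ?_⟩
  refine .jumpLt_neg rfl (by simpa [h12] using hi) ?_
  refine .jump rfl ?_
  exact ⟨⟨⟨h1, h2, h3, h4, h5, h6, h7, h8, h9, h10⟩, h11, h12, h13, h14⟩, rfl, rfl⟩

theorem reaches_skip (h : InLoop M sp qi mem out v D g s) (hpc : s.pc = 27)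
    (hlt : s.rreg 7 < M.slack) :
    Reaches sampler M.input 3 s fun s' => InLoop M sp qi mem out v D g s' ∧ s'.pc = 24 ∧
      s'.reg 3 = s.reg 3 + 1 ∧ s'.reg 4 = s.reg 4 := by
  obtain ⟨pc, reg, rreg, smem, rmem, sout⟩ := s
  obtain rfl : pc = 27 := hpc
  obtain ⟨⟨h1, h2, h3, h4, h5, h6, h7, h8, h9, h10⟩, h11, h12, h13, h14⟩ := h
  simp only at *
  refine ⟨3, le_rfl, ?_⟩
  refine .rjumpLt_pos rfl (by simpa [h5] using hlt) ?_
  refine .next rfl rfl ?_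
  refine .jump rfl ?_
  refine ⟨⟨⟨?_, ?_, ?_, ?_, ?_, ?_, ?_, ?_, h9, ?_⟩, ?_, ?_, ?_, ?_⟩, ?_, ?_, ?_⟩ <;>
    simp [exec, State.setReg, *]

theorem reaches_check (h : InLoop M sp qi mem out v D g s) (hpc : s.pc = 27)
    (hlt : ¬ s.rreg 7 < M.slack) (hi : s.reg 3 < (M.adj v).length)
    (hg : g ((M.adj v)[s.reg 3] : Fin n) ≠ 0) :
    Reaches sampler M.input 5 s fun s' => InLoop M sp qi mem out v D g s' ∧ s'.pc = 40 ∧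
      s'.reg 3 = s.reg 3 ∧ s'.reg 4 = s.reg 4 ∧ s'.rreg 5 = g ((M.adj v)[s.reg 3] : Fin n) := by
  obtain ⟨pc, reg, rreg, smem, rmem, sout⟩ := s
  obtain rfl : pc = 27 := hpc
  obtain ⟨⟨h1, h2, h3, h4, h5, h6, h7, h8, h9, h10⟩, h11, h12, h13, h14⟩ := h
  simp only at *
  have hnb := input_neighbor v hi
  rcases lt_or_gt_of_ne hg with hneg | hpos
  · refine ⟨4, by norm_num, ?_⟩
    refine .rjumpLt_neg rfl (by simpa [h5] using hlt) ?_
    iterate 2 refine .next rfl rfl ?_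
    refine .rjumpLt_pos rfl (by simp [exec, State.setReg, State.setReal, *]) ?_
    refine ⟨⟨⟨?_, ?_, ?_, ?_, ?_, ?_, ?_, ?_, h9, ?_⟩, ?_, ?_, ?_, ?_⟩, ?_, ?_, ?_, ?_⟩ <;>
      simp [exec, State.setReg, State.setReal, *]
  · refine ⟨5, le_rfl, ?_⟩
    refine .rjumpLt_neg rfl (by simpa [h5] using hlt) ?_
    iterate 2 refine .next rfl rfl ?_
    refine .rjumpLt_neg rfl (by simpa [exec, State.setReg, State.setReal, *] using hpos.le) ?_
    refine .rjumpLt_pos rfl (by simp [exec, State.setReg, State.setReal, *]) ?_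
    refine ⟨⟨⟨?_, ?_, ?_, ?_, ?_, ?_, ?_, ?_, h9, ?_⟩, ?_, ?_, ?_, ?_⟩, ?_, ?_, ?_, ?_⟩ <;>
      simp [exec, State.setReg, State.setReal, *]

/-- The pins are handed over unchanged, so `v` gets no pin from its proposal and the recursion may
visit it again. The level stays `D` here, because the callee raises it on entry and lowers it on
exit. -/
theorem reaches_call (h : InLoop M sp qi mem out v D g s) (hpc : s.pc = 27)
    (hlt : ¬ s.rreg 7 < M.slack) (hi : s.reg 3 < (M.adj v).length)
    (hg : g ((M.adj v)[s.reg 3] : Fin n) = 0) :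
    Reaches sampler M.input 13 s fun s' =>
      Base M (sp + 3) qi (Function.update (Function.update (Function.update s.mem sp v)
        (sp + 1) (s.reg 3)) (sp + 2) (s.reg 4)) out s' ∧ s'.pc = 13 ∧
        s'.reg 2 = ((M.adj v)[s.reg 3] : Fin n) ∧ s'.rreg 4 = D ∧ s'.rmem = g := by
  obtain ⟨pc, reg, rreg, smem, rmem, sout⟩ := s
  obtain rfl : pc = 27 := hpc
  obtain ⟨⟨h1, h2, h3, h4, h5, h6, h7, h8, h9, h10⟩, h11, h12, h13, h14⟩ := h
  simp only at *
  have hnb := input_neighbor v hi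
  refine ⟨13, le_rfl, ?_⟩
  refine .rjumpLt_neg rfl (by simpa [h5] using hlt) ?_
  iterate 2 refine .next rfl rfl ?_
  refine .rjumpLt_neg rfl (by simp [exec, State.setReg, State.setReal, *]) ?_
  refine .rjumpLt_neg rfl (by simp [exec, State.setReg, State.setReal, *]) ?_
  iterate 7 refine .next rfl rfl ?_
  refine .jump rfl ?_
  refine ⟨⟨?_, ?_, ?_, ?_, ?_, ?_, ?_, ?_, ?_, ?_⟩, ?_, ?_, ?_, ?_⟩ <;>
    simp [exec, State.setReg, State.setReal, *]

/-- The sign turns the pin of a neighbour into the demand on the proposal: a negative product asks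
for spin 0, a positive one for spin 1, whether β < 1 or not. -/
theorem Model.sign_mul_neg_iff (M : Model n) {x : ℝ} {b c : Fin 2}
    (h1 : 0 < x → b = 1) (h0 : x < 0 → b = 0) (hs : M.sign * x < 0) : M.Accepts c b ↔ c = 0 := by
  unfold Model.sign at hs
  unfold Model.Accepts
  split_ifs at * with hβ
  · have : b = 1 := h1 (by linarith)
    subst this; fin_cases c <;> simp
  · have : b = 0 := h0 (by linarith)
    subst this; rfl

theorem Model.sign_mul_nonneg_iff (M : Model n) {x : ℝ} {b c : Fin 2} (hx : x ≠ 0)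
    (h1 : 0 < x → b = 1) (h0 : x < 0 → b = 0) (hs : ¬ M.sign * x < 0) :
    M.Accepts c b ↔ c = 1 := by
  unfold Model.sign at hs
  unfold Model.Accepts
  split_ifs at * with hβ
  · have : b = 0 := h0 (lt_of_le_of_ne (by linarith) hx)
    subst this; fin_cases c <;> simp
  · have : b = 1 := h1 (lt_of_le_of_ne (by linarith) hx.symm)
    subst this; rfl

theorem reaches_pass (h : InLoop M sp qi mem out v D g s) (hpc : s.pc = 40) {b c : Fin 2}
    (hc : s.reg 4 = c) (hx : s.rreg 5 ≠ 0) (h1 : 0 < s.rreg 5 → b = 1) (h0 : s.rreg 5 < 0 → b = 0)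
    (hacc : M.Accepts c b) :
    Reaches sampler M.input 6 s fun s' => InLoop M sp qi mem out v D g s' ∧ s'.pc = 24 ∧
      s'.reg 3 = s.reg 3 + 1 ∧ s'.reg 4 = c := by
  obtain ⟨pc, reg, rreg, smem, rmem, sout⟩ := s
  obtain rfl : pc = 40 := hpc
  by_cases hs : M.sign * rreg 5 < 0
  · rw [M.sign_mul_neg_iff h1 h0 hs] at hacc
    subst hacc
    obtain ⟨⟨h1, h2, h3, h4, h5, h6, h7, h8, h9, h10⟩, h11, h12, h13, h14⟩ := h
    simp only at *
    refine ⟨5, by norm_num, ?_⟩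
    refine .next rfl rfl ?_
    refine .rjumpLt_pos rfl (by simp [exec, State.setReal, *]) ?_
    refine .jumpLt_neg rfl (by simp [exec, State.setReal, *]) ?_
    refine .next rfl rfl ?_
    refine .jump rfl ?_
    refine ⟨⟨⟨?_, ?_, ?_, ?_, ?_, ?_, ?_, ?_, h9, ?_⟩, ?_, ?_, ?_, ?_⟩, ?_, ?_, ?_⟩ <;>
      simp [exec, State.setReg, State.setReal, *]
  · rw [M.sign_mul_nonneg_iff hx h1 h0 hs] at hacc
    subst hacc
    obtain ⟨⟨h1, h2, h3, h4, h5, h6, h7, h8, h9, h10⟩, h11, h12, h13, h14⟩ := h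
    simp only at *
    refine ⟨6, by norm_num, ?_⟩
    refine .next rfl rfl ?_
    refine .rjumpLt_neg rfl (by simp [exec, State.setReal, *]) ?_
    refine .jumpLt_neg rfl (by simp [exec, State.setReal, *]) ?_
    refine .jump rfl ?_
    refine .next rfl rfl ?_
    refine .jump rfl ?_
    refine ⟨⟨⟨?_, ?_, ?_, ?_, ?_, ?_, ?_, ?_, h9, ?_⟩, ?_, ?_, ?_, ?_⟩, ?_, ?_, ?_⟩ <;>
      simp [exec, State.setReg, State.setReal, *]

theorem reaches_reject (h : InLoop M sp qi mem out v D g s) (hpc : s.pc = 40) {b c : Fin 2}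
    (hc : s.reg 4 = c) (hx : s.rreg 5 ≠ 0) (h1 : 0 < s.rreg 5 → b = 1) (h0 : s.rreg 5 < 0 → b = 0)
    (hacc : ¬ M.Accepts c b) :
    Reaches sampler M.input 6 s fun s' => InLoop M sp qi mem out v D g s' ∧ s'.pc = 15 := by
  obtain ⟨pc, reg, rreg, smem, rmem, sout⟩ := s
  obtain rfl : pc = 40 := hpc
  by_cases hs : M.sign * rreg 5 < 0
  · rw [M.sign_mul_neg_iff h1 h0 hs] at hacc
    obtain rfl : c = 1 := by omega
    obtain ⟨⟨h1, h2, h3, h4, h5, h6, h7, h8, h9, h10⟩, h11, h12, h13, h14⟩ := h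
    simp only at *
    refine ⟨3, by norm_num, ?_⟩
    refine .next rfl rfl ?_
    refine .rjumpLt_pos rfl (by simp [exec, State.setReal, *]) ?_
    refine .jumpLt_pos rfl (by simp [exec, State.setReal, *]) ?_
    refine ⟨⟨⟨?_, ?_, ?_, ?_, ?_, ?_, ?_, ?_, h9, ?_⟩, ?_, ?_, ?_, ?_⟩, ?_⟩ <;>
      simp [exec, State.setReal, *]
  · rw [M.sign_mul_nonneg_iff hx h1 h0 hs] at hacc
    obtain rfl : c = 0 := by omega
    obtain ⟨⟨h1, h2, h3, h4, h5, h6, h7, h8, h9, h10⟩, h11, h12, h13, h14⟩ := h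
    simp only at *
    refine ⟨3, by norm_num, ?_⟩
    refine .next rfl rfl ?_
    refine .rjumpLt_neg rfl (by simp [exec, State.setReal, *]) ?_
    refine .jumpLt_pos rfl (by simp [exec, State.setReal, *]) ?_
    refine ⟨⟨⟨?_, ?_, ?_, ?_, ?_, ?_, ?_, ?_, h9, ?_⟩, ?_, ?_, ?_, ?_⟩, ?_⟩ <;>
      simp [exec, State.setReal, *]

theorem reaches_cleanup (h : InLoop M sp qi mem out v D g s) (hpc : s.pc = 47) :
    Reaches sampler M.input 2 s fun s' => InLoop M sp qi mem out v D g s' ∧ s'.pc = 49 ∧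
      s'.reg 3 = 0 ∧ s'.reg 4 = s.reg 4 ∧ s'.rreg 6 = D * D := by
  obtain ⟨pc, reg, rreg, smem, rmem, sout⟩ := s
  obtain rfl : pc = 47 := hpc
  obtain ⟨⟨h1, h2, h3, h4, h5, h6, h7, h8, h9, h10⟩, h11, h12, h13, h14⟩ := h
  simp only at *
  refine ⟨2, le_rfl, ?_⟩
  iterate 2 refine .next rfl rfl ?_
  refine ⟨⟨⟨?_, ?_, ?_, ?_, ?_, ?_, ?_, ?_, h9, ?_⟩, ?_, ?_, ?_, ?_⟩, ?_, ?_, ?_, ?_⟩ <;>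
    simp [exec, State.setReg, State.setReal, *]

/-- Squares replace absolute values: pins made in the current loop have absolute value `D`, older
ones are strictly smaller. -/
theorem reaches_keep (h : InLoop M sp qi mem out v D g s) (hpc : s.pc = 49)
    (hi : s.reg 3 < (M.adj v).length) (hD : s.rreg 6 = D * D)
    (hg : g ((M.adj v)[s.reg 3] : Fin n) * g ((M.adj v)[s.reg 3] : Fin n) < D * D) :
    Reaches sampler M.input 8 s fun s' => InLoop M sp qi mem out v D g s' ∧ s'.pc = 49 ∧
      s'.reg 3 = s.reg 3 + 1 ∧ s'.reg 4 = s.reg 4 ∧ s'.rreg 6 = D * D := by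
  obtain ⟨pc, reg, rreg, smem, rmem, sout⟩ := s
  obtain rfl : pc = 49 := hpc
  obtain ⟨⟨h1, h2, h3, h4, h5, h6, h7, h8, h9, h10⟩, h11, h12, h13, h14⟩ := h
  simp only at *
  have hnb := input_neighbor v hi
  refine ⟨7, by norm_num, ?_⟩
  refine .jumpLt_pos rfl (by simpa [h12] using hi) ?_
  iterate 3 refine .next rfl rfl ?_
  refine .rjumpLt_pos rfl (by simp [exec, State.setReg, State.setReal, *]) ?_
  refine .next rfl rfl ?_
  refine .jump rfl ?_
  refine ⟨⟨⟨?_, ?_, ?_, ?_, ?_, ?_, ?_, ?_, h9, ?_⟩, ?_, ?_, ?_, ?_⟩, ?_, ?_, ?_, ?_⟩ <;>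
    simp [exec, State.setReg, State.setReal, *]

theorem reaches_unpin (h : InLoop M sp qi mem out v D g s) (hpc : s.pc = 49)
    (hi : s.reg 3 < (M.adj v).length) (hD : s.rreg 6 = D * D)
    (hg : ¬ g ((M.adj v)[s.reg 3] : Fin n) * g ((M.adj v)[s.reg 3] : Fin n) < D * D) :
    Reaches sampler M.input 8 s fun s' =>
      InLoop M sp qi mem out v D (Function.update g ((M.adj v)[s.reg 3] : Fin n) 0) s' ∧
      s'.pc = 49 ∧ s'.reg 3 = s.reg 3 + 1 ∧ s'.reg 4 = s.reg 4 ∧ s'.rreg 6 = D * D := by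
  obtain ⟨pc, reg, rreg, smem, rmem, sout⟩ := s
  obtain rfl : pc = 49 := hpc
  obtain ⟨⟨h1, h2, h3, h4, h5, h6, h7, h8, h9, h10⟩, h11, h12, h13, h14⟩ := h
  simp only at *
  have hnb := input_neighbor v hi
  refine ⟨8, by norm_num, ?_⟩
  refine .jumpLt_pos rfl (by simpa [h12] using hi) ?_
  iterate 3 refine .next rfl rfl ?_
  refine .rjumpLt_neg rfl (by simp [exec, State.setReg, State.setReal, *]) ?_
  iterate 2 refine .next rfl rfl ?_
  refine .jump rfl ?_
  refine ⟨⟨⟨?_, ?_, ?_, ?_, ?_, ?_, ?_, ?_, h9, ?_⟩, ?_, ?_, ?_, ?_⟩, ?_, ?_, ?_, ?_⟩ <;>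
    simp [exec, State.setReg, State.setReal, *]

theorem reaches_leave (h : InLoop M sp qi mem out v D g s) (hpc : s.pc = 49)
    (hi : (M.adj v).length ≤ s.reg 3) :
    Reaches sampler M.input 3 s fun s' => Base M sp qi mem out s' ∧ s'.pc = 59 ∧ s'.reg 2 = v ∧
      s'.reg 4 = s.reg 4 ∧ s'.rreg 4 = D - 1 ∧ s'.rmem = g := by
  obtain ⟨pc, reg, rreg, smem, rmem, sout⟩ := s
  obtain rfl : pc = 49 := hpc
  obtain ⟨⟨h1, h2, h3, h4, h5, h6, h7, h8, h9, h10⟩, h11, h12, h13, h14⟩ := h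
  simp only at *
  refine ⟨3, by norm_num, ?_⟩
  refine .jumpLt_neg rfl (by simpa [h12] using hi) ?_
  refine .jump rfl ?_
  refine .next rfl rfl ?_
  refine ⟨⟨?_, ?_, ?_, ?_, ?_, ?_, ?_, ?_, h9, ?_⟩, ?_, ?_, ?_, ?_, ?_⟩ <;>
    simp [exec, State.setReal, *]

theorem reaches_pinned (h : Base M sp qi mem out s) (hpc : s.pc = 59) {b : Fin 2} {u : ℕ}
    (hu : s.reg 2 = u) (hb : s.reg 4 = b) :
    Reaches sampler M.input 4 s fun s' => Base M sp qi mem out s' ∧ s'.pc = 63 ∧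
      s'.reg 2 = u ∧ s'.reg 4 = b ∧ s'.rreg 4 = s.rreg 4 ∧
      s'.rmem = Function.update s.rmem u (pin (s.rreg 4) b) ∧ s'.rreg 5 = pin (s.rreg 4) b := by
  obtain ⟨pc, reg, rreg, smem, rmem, sout⟩ := s
  obtain rfl : pc = 59 := hpc
  obtain ⟨h1, h2, h3, h4, h5, h6, h7, h8, h9, h10⟩ := h
  simp only at *
  by_cases hb0 : b = 0
  · subst hb0
    refine ⟨4, le_rfl, ?_⟩
    refine .next rfl rfl ?_
    refine .jumpLt_neg rfl (by simp [exec, State.setReal, *]) ?_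
    iterate 2 refine .next rfl rfl ?_
    refine ⟨⟨?_, ?_, ?_, ?_, ?_, ?_, ?_, ?_, h9, ?_⟩, ?_, ?_, ?_, ?_, ?_, ?_⟩ <;>
      simp [exec, State.setReal, pin, *]
  · obtain rfl : b = 1 := by omega
    refine ⟨3, by norm_num, ?_⟩
    refine .next rfl rfl ?_
    refine .jumpLt_pos rfl (by simp [exec, State.setReal, *]) ?_
    refine .next rfl rfl ?_
    refine ⟨⟨?_, ?_, ?_, ?_, ?_, ?_, ?_, ?_, h9, ?_⟩, ?_, ?_, ?_, ?_, ?_, ?_⟩ <;>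
      simp [exec, State.setReal, pin, *]

/-- The frame lies below the height `sp + 3`, so `Base` guarantees that the call has preserved it.
Real register 5 survives the pop with the pin just made, so the caller can resume at the comparison.
-/
theorem reaches_pop {smem : ℕ → ℕ} {i c : ℕ} (hmem : ∀ m < sp, smem m = mem m)
    (h : Base M (sp + 3) qi (Function.update (Function.update (Function.update smem sp v)
        (sp + 1) i) (sp + 2) c) out s) (hpc : s.pc = 63) :
    Reaches sampler M.input 9 s fun s' => InLoop M sp qi mem out v (s.rreg 4) s.rmem s' ∧
      s'.pc = 40 ∧ s'.reg 3 = i ∧ s'.reg 4 = c ∧ s'.rreg 5 = s.rreg 5 := by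
  obtain ⟨pc, reg, rreg, tmem, rmem, sout⟩ := s
  obtain rfl : pc = 63 := hpc
  obtain ⟨h1, h2, h3, h4, h5, h6, h7, h8, h9, h10⟩ := h
  simp only at *
  have e0 : tmem sp = v := by
    rw [h9 sp (by omega)]
    simp
  have e1 : tmem (sp + 1) = i := by
    rw [h9 (sp + 1) (by omega)]
    simp
  have e2 : tmem (sp + 2) = c := by
    rw [h9 (sp + 2) (by omega)]
    simp
  have e3 : ∀ m < sp, tmem m = mem m := fun m hm => by
    rw [h9 m (by omega), Function.update_of_ne (by omega), Function.update_of_ne (by omega),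
      Function.update_of_ne (by omega), hmem m hm]
  clear h9
  refine ⟨9, le_rfl, ?_⟩
  refine .jumpLt_pos rfl (by simp [*]) ?_
  iterate 7 refine .next rfl rfl ?_
  refine .jump rfl ?_
  refine ⟨⟨⟨?_, ?_, ?_, ?_, ?_, ?_, ?_, ?_, e3, ?_⟩, ?_, ?_, ?_, ?_⟩, ?_, ?_, ?_, ?_⟩ <;>
    simp [exec, State.setReg, input_degree, *]

theorem reaches_output (h : Base M 0 qi mem out s) (hpc : s.pc = 63) :
    Reaches sampler M.input 4 s fun s' =>
      Base M 0 (qi + 1) mem (Function.update out (s.reg 2) (some (s.reg 4))) s' ∧ s'.pc = 9 ∧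
      s'.rreg 4 = s.rreg 4 ∧ s'.rmem = s.rmem := by
  obtain ⟨pc, reg, rreg, smem, rmem, sout⟩ := s
  obtain rfl : pc = 63 := hpc
  obtain ⟨h1, h2, h3, h4, h5, h6, h7, h8, h9, h10⟩ := h
  simp only at *
  refine ⟨4, le_rfl, ?_⟩
  refine .jumpLt_neg rfl (by simp [*]) ?_
  iterate 2 refine .next rfl rfl ?_
  refine .jump rfl ?_
  refine ⟨⟨?_, ?_, ?_, ?_, ?_, ?_, ?_, ?_, h9, ?_⟩, ?_, ?_, ?_⟩ <;>
    simp [exec, State.setReg, *]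

theorem reaches_query (h : Base M sp qi mem out s) (hpc : s.pc = 9) (hq : qi < M.query.length) :
    Reaches sampler M.input 3 s fun s' => Base M sp qi mem out s' ∧ s'.pc = 13 ∧
      s'.reg 2 = M.query[qi] ∧ s'.rreg 4 = s.rreg 4 ∧ s'.rmem = s.rmem := by
  obtain ⟨pc, reg, rreg, smem, rmem, sout⟩ := s
  obtain rfl : pc = 9 := hpc
  obtain ⟨h1, h2, h3, h4, h5, h6, h7, h8, h9, h10⟩ := h
  simp only at *
  refine ⟨3, le_rfl, ?_⟩
  refine .next rfl rfl ?_
  refine .jumpLt_pos rfl (by simp [exec, State.setReg, Model.input, *]) ?_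
  refine .next rfl rfl ?_
  refine ⟨⟨?_, ?_, ?_, ?_, ?_, ?_, ?_, ?_, h9, ?_⟩, ?_, ?_, ?_, ?_⟩ <;>
    simp [exec, State.setReg, Model.input, Input.queryAt, *]

theorem reaches_halt (h : Base M sp qi mem out s) (hpc : s.pc = 9) (hq : M.query.length ≤ qi) :
    Reaches sampler M.input 3 s fun s' => Halted sampler s' ∧ s'.out = out := by
  obtain ⟨pc, reg, rreg, smem, rmem, sout⟩ := s
  obtain rfl : pc = 9 := hpc
  obtain ⟨h1, h2, h3, h4, h5, h6, h7, h8, h9, h10⟩ := h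
  simp only at *
  refine ⟨3, le_rfl, ?_⟩
  refine .next rfl rfl ?_
  refine .jumpLt_neg rfl (by simp [exec, State.setReg, Model.input, *]) ?_
  refine .jump rfl ?_
  exact ⟨le_refl 75, h10⟩

theorem reaches_start (M : Model n) :
    Reaches sampler M.input 8 State.init fun s' => Base M 0 0 (fun _ => 0) (fun _ => none) s' ∧
      s'.pc = 9 ∧ s'.rreg 4 = 1 ∧ s'.rmem = fun _ => 0 := by
  by_cases hβ : M.β < 1
  · refine ⟨7, by norm_num, ?_⟩
    iterate 5 refine .next rfl rfl ?_
    refine .rjumpLt_pos rfl (by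
      simpa [exec, State.setReg, State.setReal, Model.input] using hβ) ?_
    refine .next rfl rfl ?_
    refine ⟨⟨?_, ?_, ?_, ?_, ?_, ?_, ?_, ?_, ?_, ?_⟩, ?_, ?_, ?_⟩ <;>
      simp [exec, State.setReg, State.setReal, State.init, Model.input, Model.slack, Model.sign, hβ]
  · refine ⟨8, le_rfl, ?_⟩
    iterate 5 refine .next rfl rfl ?_
    refine .rjumpLt_neg rfl (by
      simpa [exec, State.setReg, State.setReal, Model.input] using hβ) ?_
    refine .next rfl rfl ?_
    refine .jump rfl ?_
    refine ⟨⟨?_, ?_, ?_, ?_, ?_, ?_, ?_, ?_, ?_, ?_⟩, ?_, ?_, ?_⟩ <;>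
      simp [exec, State.setReg, State.setReal, State.init, Model.input, Model.slack, Model.sign, hβ]

end

/-! ### Budgets -/

section

variable {n : ℕ} {M : Model n}

theorem half_le_one_sub_pow {Δ : ℕ} (hΔ : 1 ≤ Δ) : 1 / 2 ≤ (1 - 1 / (2 * (Δ : ℝ))) ^ Δ := by
  have h1 : (1 : ℝ) ≤ Δ := by exact_mod_cast hΔ
  have h2 : 1 / (2 * (Δ : ℝ)) ≤ 1 / 2 := by
    apply one_div_le_one_div_of_le <;> linarith
  have h := one_add_mul_le_pow (a := -(1 / (2 * (Δ : ℝ)))) (by linarith) Δ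
  have e : 1 + (Δ : ℝ) * -(1 / (2 * (Δ : ℝ))) = 1 / 2 := by field_simp; norm_num
  rw [e] at h
  simpa [sub_eq_add_neg] using h

/-- Bernoulli with the real exponent Δ/2 ≥ 1 gives 3/4, then square. The gain over 1/2 is essential:
with 1/2 the reveal rate would have to be at least 1/(Δ + 1), and Δ such reveals bring the branching
factor to 1 as Δ grows. -/
theorem nine_div_sixteen_le_one_sub_pow {Δ : ℕ} (hΔ : 2 ≤ Δ) :
    9 / 16 ≤ (1 - 1 / (2 * (Δ : ℝ))) ^ Δ := by
  have h1 : (2 : ℝ) ≤ Δ := by exact_mod_cast hΔ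
  have h2 : 1 / (2 * (Δ : ℝ)) ≤ 1 / 2 := by
    apply one_div_le_one_div_of_le <;> linarith
  have h := one_add_mul_self_le_rpow_one_add (s := -(1 / (2 * (Δ : ℝ)))) (by linarith)
    (p := (Δ : ℝ) / 2) (by linarith)
  have e : 1 + (Δ : ℝ) / 2 * -(1 / (2 * (Δ : ℝ))) = 3 / 4 := by field_simp; norm_num
  rw [e, ← sub_eq_add_neg] at h
  have h3 : ((1 - 1 / (2 * (Δ : ℝ))) ^ ((Δ : ℝ) / 2)) ^ 2 = (1 - 1 / (2 * (Δ : ℝ))) ^ Δ := by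
    rw [← Real.rpow_natCast _ 2, ← Real.rpow_mul (by linarith), ← Real.rpow_natCast]
    congr 1
    push_cast
    ring
  rw [← h3]
  nlinarith

namespace Model

/-- A bound for the probability that the loop at a vertex reveals a given free neighbour. -/
def revealRate (M : Model n) : ℝ := 8 / (9 * M.Δ)

/-- The expected number of steps of a rejection loop without free neighbours. -/
def roundsCost (M : Model n) : ℝ := 100 + 80 * M.Δ

/-- The expected number of steps of a call of the sampling routine. -/
def callCost (M : Model n) : ℝ := 9 * (130 + 89 * M.Δ)

open Classical in
/-- The number of free vertices in `l`. -/
def free (g : ℕ → ℝ) (l : List (Fin n)) : ℝ := (l.map fun u : Fin n => if g u = 0 then (1 : ℝ) else 0).sum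

/-- The budget of the rejection loop. -/
def loopCost (M : Model n) (v : Fin n) (g : ℕ → ℝ) : ℝ :=
  M.roundsCost + M.callCost * M.revealRate * free g (M.adj v)

/-- The budget when the edges to the vertices of `l` are still to be examined in this round. -/
def edgeCost (M : Model n) (v : Fin n) (g : ℕ → ℝ) (l : List (Fin n)) : ℝ :=
  40 * (l.length + 1) + M.roundsCost * (1 - M.slack ^ l.length) +
    M.callCost * ((1 - M.slack ^ l.length) * M.revealRate * free g (M.adj v) +
      (1 - M.slack) * (1 - M.revealRate) * free g l)

theorem free_nonneg (g : ℕ → ℝ) (l : List (Fin n)) : 0 ≤ free g l := by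
  refine List.sum_nonneg fun x hx => ?_
  obtain ⟨u, -, rfl⟩ := List.mem_map.1 hx
  split_ifs <;> norm_num

theorem free_le_length (g : ℕ → ℝ) (l : List (Fin n)) : free g l ≤ l.length := by
  induction l with
  | nil => simp [free]
  | cons u l ih =>
    simp only [free, List.map_cons, List.sum_cons, List.length_cons] at ih ⊢
    push_cast
    split_ifs <;> linarith

theorem free_cons_of_eq {g : ℕ → ℝ} {u : Fin n} (h : g u = 0) (l : List (Fin n)) :
    free g (u :: l) = 1 + free g l := by
  simp [free, h]

theorem free_cons_of_ne {g : ℕ → ℝ} {u : Fin n} (h : g u ≠ 0) (l : List (Fin n)) :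
    free g (u :: l) = free g l := by
  simp [free, h]

theorem free_drop_le (g : ℕ → ℝ) (l : List (Fin n)) (i : ℕ) : free g (l.drop i) ≤ free g l := by
  conv_rhs => rw [← List.take_append_drop i l]
  have h := free_nonneg g (l.take i)
  unfold free at *
  rw [List.map_append, List.sum_append]
  linarith

theorem free_update_of_notMem {g : ℕ → ℝ} {u : Fin n} {l : List (Fin n)} (h : u ∉ l) (x : ℝ) :
    free (Function.update g u x) l = free g l := by
  unfold free
  congr 1
  refine List.map_congr_left fun y hy => ?_
  have : y ≠ u := ne_of_mem_of_not_mem hy h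
  rw [Function.update_of_ne (by simpa [Fin.ext_iff] using this)]

theorem free_update_of_mem {g : ℕ → ℝ} {u : Fin n} {l : List (Fin n)} (hl : l.Nodup) (h : u ∈ l)
    (hu : g u = 0) {x : ℝ} (hx : x ≠ 0) : free (Function.update g u x) l = free g l - 1 := by
  induction l with
  | nil => cases h
  | cons y l ih =>
    obtain ⟨hy, hl⟩ := List.nodup_cons.1 hl
    by_cases hyu : y = u
    · subst hyu
      rw [free_cons_of_eq hu, free_cons_of_ne (by simpa using hx), free_update_of_notMem hy]
      ring
    · have hm : u ∈ l := (List.mem_cons.1 h).resolve_left (Ne.symm hyu)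
      have hne : Function.update g (u : ℕ) x (y : ℕ) = g y :=
        Function.update_of_ne (by simpa [Fin.ext_iff] using hyu) _ _
      by_cases hg : g y = 0
      · rw [free_cons_of_eq (hne.trans hg), free_cons_of_eq hg, ih hl hm]
        ring
      · rw [free_cons_of_ne (by rwa [hne]), free_cons_of_ne hg, ih hl hm]

theorem Good.one_le_degree (hM : M.Good) : (1 : ℝ) ≤ M.Δ := by exact_mod_cast hM.one_le

theorem callCost_pos (M : Model n) : 0 < M.callCost := by unfold callCost; positivity

theorem roundsCost_pos (M : Model n) : 0 < M.roundsCost := by unfold roundsCost; positivity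

theorem Good.revealRate_pos (hM : M.Good) : 0 < M.revealRate := by
  have := hM.one_le_degree
  unfold revealRate; positivity

theorem Good.revealRate_lt_one (hM : M.Good) : M.revealRate < 1 := by
  have := hM.one_le_degree
  unfold revealRate
  rw [div_lt_one (by positivity)]
  linarith

theorem loopCost_nonneg (hM : M.Good) (v : Fin n) (g : ℕ → ℝ) : 0 ≤ M.loopCost v g :=
  add_nonneg M.roundsCost_pos.le
    (mul_nonneg (mul_nonneg M.callCost_pos.le hM.revealRate_pos.le) (free_nonneg _ _))

theorem Good.slack_pow_le (hM : M.Good) {d : ℕ} (hd : d ≤ M.Δ) :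
    (1 - 1 / (2 * (M.Δ : ℝ))) ^ M.Δ ≤ M.slack ^ d := by
  have h1 := hM.one_le_degree
  have h2 : 1 / (2 * (M.Δ : ℝ)) ≤ 1 / 2 := by
    apply one_div_le_one_div_of_le <;> linarith
  calc (1 - 1 / (2 * (M.Δ : ℝ))) ^ M.Δ ≤ M.slack ^ M.Δ :=
        pow_le_pow_left₀ (by linarith) hM.le_slack _
    _ ≤ M.slack ^ d := pow_le_pow_of_le_one hM.slack_pos.le hM.slack_le_one hd

theorem Good.half_le_slack_pow (hM : M.Good) {d : ℕ} (hd : d ≤ M.Δ) : 1 / 2 ≤ M.slack ^ d :=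
  (half_le_one_sub_pow hM.one_le).trans (hM.slack_pow_le hd)

/-- This is what makes the reveal rate r self-consistent. In a round an edge makes a demand with
probability 1 − p, and a reveal costs only 1 − r beyond the share r already reserved. The
probability, at least p^d, that d edges all impose nothing must pay for it out of r. The value
8/(9Δ) solves 1/(2Δ) = (9/16) r, which settles Δ ≥ 2; for Δ = 1 the bound 1/2 suffices. -/
theorem Good.trigger_le (hM : M.Good) {d : ℕ} (hd : d ≤ M.Δ) :
    (1 - M.slack) * (1 - M.revealRate) ≤ M.slack ^ d * M.revealRate := by
  have h1 := hM.one_le_degree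
  have h2 := hM.le_slack
  have h3 := hM.revealRate_lt_one
  have h4 := hM.revealRate_pos
  have h5 : (1 - M.slack) * (1 - M.revealRate) ≤ 1 / (2 * M.Δ) * (1 - M.revealRate) := by
    gcongr
    · linarith
  refine h5.trans ?_
  rcases hM.one_le.eq_or_lt with hΔ | hΔ
  · have h6 := hM.half_le_slack_pow hd
    have h7 : 1 / 2 * M.revealRate ≤ M.slack ^ d * M.revealRate := by gcongr
    refine le_trans ?_ h7
    unfold revealRate
    rw [← hΔ]
    norm_num
  · have h6 := (nine_div_sixteen_le_one_sub_pow hΔ).trans (hM.slack_pow_le hd)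
    have h7 : 9 / 16 * M.revealRate ≤ M.slack ^ d * M.revealRate := by gcongr
    refine le_trans ?_ h7
    have h8 : 1 / (2 * (M.Δ : ℝ)) = 9 / 16 * M.revealRate := by
      unfold revealRate
      field_simp
      norm_num
    rw [h8]
    nlinarith

/-- In `edgeCost`, 1 − p^|l| bounds the probability of a restart, which needs a new loop budget, and
each free vertex of `l` adds (1 − p)(1 − r) calls. The comparison lets a check continue under the
same budget whether the demand is met or violated. -/
theorem Good.edgeCost_le_loopCost (hM : M.Good) (v : Fin n) (g : ℕ → ℝ) (i : ℕ) :
    M.edgeCost v g ((M.adj v).drop i) ≤ M.loopCost v g := by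
  set l := (M.adj v).drop i
  have hl : l.length ≤ M.Δ := (by simp [l] : l.length ≤ (M.adj v).length).trans (hM.length_le v)
  have hl' : (l.length : ℝ) ≤ M.Δ := by exact_mod_cast hl
  have h1 := hM.half_le_slack_pow hl
  have h2 := hM.trigger_le hl
  have h3 : free g l ≤ free g (M.adj v) := free_drop_le g _ i
  have h4 := free_nonneg g l
  have hp := hM.slack_pos
  have h5 : (1 - M.slack) * (1 - M.revealRate) * free g l ≤
      M.slack ^ l.length * M.revealRate * free g (M.adj v) := by
    have := hM.revealRate_pos
    exact mul_le_mul h2 h3 h4 (by positivity)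
  have h6 : 40 * ((l.length : ℝ) + 1) ≤ M.roundsCost * M.slack ^ l.length := by
    have : M.roundsCost * (1 / 2) ≤ M.roundsCost * M.slack ^ l.length :=
      mul_le_mul_of_nonneg_left h1 M.roundsCost_pos.le
    unfold roundsCost at *
    linarith
  have h7 := mul_le_mul_of_nonneg_left h5 M.callCost_pos.le
  unfold edgeCost loopCost
  linarith

theorem Good.add_edgeCost_le_loopCost (hM : M.Good) (v : Fin n) (g : ℕ → ℝ) :
    10 + M.edgeCost v g (M.adj v) ≤ M.loopCost v g := by
  have hl := hM.length_le v
  have hl' : ((M.adj v).length : ℝ) ≤ M.Δ := by exact_mod_cast hl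
  have h1 := hM.half_le_slack_pow hl
  have h2 := hM.trigger_le hl
  have h4 := free_nonneg g (M.adj v)
  have h5 := mul_le_mul_of_nonneg_left (mul_le_mul_of_nonneg_right h2 h4) M.callCost_pos.le
  have h6 : 10 + 40 * (((M.adj v).length : ℝ) + 1) ≤
      M.roundsCost * M.slack ^ (M.adj v).length := by
    have : M.roundsCost * (1 / 2) ≤ M.roundsCost * M.slack ^ (M.adj v).length :=
      mul_le_mul_of_nonneg_left h1 M.roundsCost_pos.le
    unfold roundsCost at *
    linarith
  unfold edgeCost loopCost
  linarith

theorem Good.edgeCost_cons_of_ne (hM : M.Good) (v : Fin n) {g : ℕ → ℝ} {u : Fin n} (hu : g u ≠ 0)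
    (l : List (Fin n)) :
    40 + M.slack * M.edgeCost v g l + (1 - M.slack) * M.loopCost v g ≤ M.edgeCost v g (u :: l) := by
  have hp := hM.slack_le_one
  have hr := hM.revealRate_lt_one
  have h1 : 0 ≤ 40 * ((l.length : ℝ) + 1) * (1 - M.slack) :=
    mul_nonneg (by positivity) (by linarith)
  have h2 : 0 ≤ M.callCost * ((1 - M.slack) ^ 2 * (1 - M.revealRate) * free g l) :=
    mul_nonneg M.callCost_pos.le
      (mul_nonneg (mul_nonneg (sq_nonneg _) (by linarith)) (free_nonneg _ _))
  unfold edgeCost loopCost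
  rw [free_cons_of_ne hu, List.length_cons, pow_succ]
  push_cast
  linarith

/-- After a reveal the loop has one free neighbour less, hence the refund of `callCost *
revealRate`. The restart terms match through 1 − p^(m+1) = p(1 − p^m) + (1 − p), and the remainder
is nonnegative. -/
theorem Good.edgeCost_cons_of_eq (hM : M.Good) (v : Fin n) {g : ℕ → ℝ} {u : Fin n} (hu : g u = 0)
    (l : List (Fin n)) :
    40 + M.slack * M.edgeCost v g l +
      (1 - M.slack) * (M.callCost + M.loopCost v g - M.callCost * M.revealRate) ≤
      M.edgeCost v g (u :: l) := by
  have hp := hM.slack_le_one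
  have hr := hM.revealRate_lt_one
  have h1 : 0 ≤ 40 * ((l.length : ℝ) + 1) * (1 - M.slack) :=
    mul_nonneg (by positivity) (by linarith)
  have h2 : 0 ≤ M.callCost * ((1 - M.slack) ^ 2 * (1 - M.revealRate) * free g l) :=
    mul_nonneg M.callCost_pos.le
      (mul_nonneg (mul_nonneg (sq_nonneg _) (by linarith)) (free_nonneg _ _))
  unfold edgeCost loopCost
  rw [free_cons_of_eq hu, List.length_cons, pow_succ]
  push_cast
  linarith

theorem Good.loopCost_update (hM : M.Good) {v u : Fin n} (hu : u ∈ M.adj v) {g : ℕ → ℝ}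
    (hg : g u = 0) {x : ℝ} (hx : x ≠ 0) :
    M.loopCost v (Function.update g u x) = M.loopCost v g - M.callCost * M.revealRate := by
  unfold loopCost
  rw [free_update_of_mem (hM.nodup v) hu hg hx]
  ring

/-- The branching equation: at most Δ free neighbours at rate 8/(9Δ) cost 8/9 of a call, and the
remaining ninth of `callCost` is exactly the local cost 130 + 89Δ. -/
theorem Good.loopCost_le_callCost (hM : M.Good) (v : Fin n) (g : ℕ → ℝ) :
    30 + 9 * M.Δ + M.loopCost v g ≤ M.callCost := by
  have h1 := hM.one_le_degree
  have h2 : free g (M.adj v) ≤ M.Δ :=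
    (free_le_length g _).trans (by exact_mod_cast hM.length_le v)
  have h3 : M.revealRate * free g (M.adj v) ≤ 8 / 9 := by
    calc M.revealRate * free g (M.adj v) ≤ M.revealRate * M.Δ :=
          mul_le_mul_of_nonneg_left h2 hM.revealRate_pos.le
      _ = 8 / 9 := by unfold revealRate; field_simp
  have h4 := mul_le_mul_of_nonneg_left h3 M.callCost_pos.le
  unfold loopCost
  unfold callCost roundsCost at *
  linarith

end Model

end

/-! ### Simultaneous induction for the rejection loop and the recursive call -/

section

variable {n : ℕ} {M : Model n} {κ : ℝ} {F : State → ℝ≥0∞} {k : ℕ}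

theorem Model.Good.edgeCost_nonneg (hM : M.Good) (v : Fin n) (g : ℕ → ℝ) (l : List (Fin n)) :
    0 ≤ M.edgeCost v g l := by
  have h1 : 0 ≤ 1 - M.slack ^ l.length :=
    sub_nonneg.2 (pow_le_one₀ hM.slack_pos.le hM.slack_le_one)
  have h2 := hM.slack_le_one
  have h3 := hM.revealRate_lt_one
  have h4 := hM.revealRate_pos
  have h5 := M.callCost_pos
  have h6 := M.roundsCost_pos
  have h7 := Model.free_nonneg g l
  have h8 := Model.free_nonneg g (M.adj v)
  have h9 : 0 ≤ 1 - M.slack := by linarith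
  have h10 : 0 ≤ 1 - M.revealRate := by linarith
  unfold Model.edgeCost
  positivity

/-- The pins `g` arise from `f` by pinning free neighbours of `v` at level `D`. -/
def LoopPins (l : List (Fin n)) (f : ℕ → ℝ) (D : ℝ) (g : ℕ → ℝ) : Prop :=
  ∀ m, g m = f m ∨ (f m = 0 ∧ |g m| = D ∧ ∃ u ∈ l, (u : ℕ) = m)

/-- The bound `B b` holds whenever the loop at `v` accepts the spin `b`. -/
def AcceptBound (M : Model n) (κ : ℝ) (F : State → ℝ≥0∞) (k : ℕ) (sp qi : ℕ) (mem : ℕ → ℕ)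
    (out : ℕ → Option ℕ) (v : Fin n) (f : ℕ → ℝ) (D : ℝ) (B : Fin 2 → ℝ) : Prop :=
  ∀ b, 0 < M.lam v b → ∀ g s, LoopPins (M.adj v) f D g → InLoop M sp qi mem out v D g s →
    s.pc = 47 → s.reg 4 = b → value sampler M.input (.ofReal κ) F k s ≤ .ofReal (B b)

/-- The specification of the rejection loop for computations of length `k`. -/
def LoopBound (M : Model n) (κ : ℝ) (F : State → ℝ≥0∞) (k : ℕ) : Prop :=
  ∀ ⦃sp qi : ℕ⦄ ⦃mem : ℕ → ℕ⦄ ⦃out : ℕ → Option ℕ⦄ ⦃v : Fin n⦄ ⦃f : ℕ → ℝ⦄ ⦃D : ℝ⦄ ⦃B : Fin 2 → ℝ⦄,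
    0 < D → (∀ m, |f m| < D) → (∀ b, 0 ≤ B b) → AcceptBound M κ F k sp qi mem out v f D B →
    ∀ g s, LoopPins (M.adj v) f D g → M.Valid g → InLoop M sp qi mem out v D g s → s.pc = 15 →
      value sampler M.input (.ofReal κ) F k s ≤
        .ofReal (κ * M.loopCost v g + condExp M.w g (M.localMean v B))

/-- The bound `B b` holds whenever the sampling routine returns the spin `b` of `v`. -/
def ReturnBound (M : Model n) (κ : ℝ) (F : State → ℝ≥0∞) (k : ℕ) (sp qi : ℕ) (mem : ℕ → ℕ)
    (out : ℕ → Option ℕ) (v : Fin n) (f : ℕ → ℝ) (D : ℝ) (B : Fin 2 → ℝ) : Prop :=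
  ∀ b, 0 < M.lam v b → ∀ s, Base M sp qi mem out s → s.pc = 59 → s.reg 2 = v → s.reg 4 = b →
    s.rreg 4 = D → s.rmem = f → value sampler M.input (.ofReal κ) F k s ≤ .ofReal (B b)

/-- The specification of the sampling routine for computations of length `k`. -/
def SampleBound (M : Model n) (κ : ℝ) (F : State → ℝ≥0∞) (k : ℕ) : Prop :=
  ∀ ⦃sp qi : ℕ⦄ ⦃mem : ℕ → ℕ⦄ ⦃out : ℕ → Option ℕ⦄ ⦃v : Fin n⦄ ⦃f : ℕ → ℝ⦄ ⦃D : ℝ⦄ ⦃B : Fin 2 → ℝ⦄,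
    0 < D → (∀ m, |f m| ≤ D) → f v = 0 → M.Valid f → (∀ b, 0 ≤ B b) →
    ReturnBound M κ F k sp qi mem out v f D B →
    ∀ s, Base M sp qi mem out s → s.pc = 13 → s.reg 2 = v → s.rreg 4 = D → s.rmem = f →
      value sampler M.input (.ofReal κ) F k s ≤
        .ofReal (κ * M.callCost + condExp M.w f (fun σ => B (σ v)))

theorem AcceptBound.of_succ {sp qi : ℕ} {mem : ℕ → ℕ} {out : ℕ → Option ℕ} {v : Fin n} {f : ℕ → ℝ}
    {D : ℝ} {B : Fin 2 → ℝ} (h : AcceptBound M κ F (k + 1) sp qi mem out v f D B) :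
    AcceptBound M κ F k sp qi mem out v f D B := fun b hb g s h1 h2 h3 h4 =>
  (value_le_succ k s).trans (h b hb g s h1 h2 h3 h4)

theorem LoopPins.abs_le {l : List (Fin n)} {f g : ℕ → ℝ} {D : ℝ} (h : LoopPins l f D g)
    (hf : ∀ m, |f m| < D) (m : ℕ) : |g m| ≤ D := by
  rcases h m with h | h
  · rw [h]; exact (hf m).le
  · exact h.2.1.le

theorem LoopPins.update {l : List (Fin n)} {f g : ℕ → ℝ} {D : ℝ} (h : LoopPins l f D g)
    (hD : 0 < D) {u : Fin n} (hu : u ∈ l) (hg : g u = 0) (b : Fin 2) :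
    LoopPins l f D (Function.update g u (pin D b)) := by
  intro m
  by_cases hm : m = u
  · subst hm
    refine Or.inr ⟨?_, by rw [Function.update_self, abs_pin hD], u, hu, rfl⟩
    rcases h u with h | h
    · rw [← h, hg]
    · exact h.1
  · rw [Function.update_of_ne hm]
    exact h m

/-- Under the conditional law the spin of a pinned neighbour is deterministic, so `checkMean`
collapses to one of its two branches. -/
theorem check_bound (hM : M.Good) (hκ : 0 ≤ κ) {sp qi : ℕ} {mem : ℕ → ℕ} {out : ℕ → Option ℕ}
    {v u : Fin n} {D : ℝ} {g : ℕ → ℝ} {B : Fin 2 → ℝ} (hB : ∀ b, 0 ≤ B b) {c : Fin 2} {i : ℕ}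
    {l : List (Fin n)}
    (hloop : ∀ s, InLoop M sp qi mem out v D g s → s.pc = 15 →
      value sampler M.input (.ofReal κ) F k s ≤
        .ofReal (κ * M.loopCost v g + condExp M.w g (M.localMean v B)))
    (hedge : ∀ s, InLoop M sp qi mem out v D g s → s.pc = 24 → s.reg 3 = i + 1 → s.reg 4 = c →
      value sampler M.input (.ofReal κ) F k s ≤
        .ofReal (κ * M.loopCost v g + condExp M.w g (M.roundMean v B c l)))
    (hu : g u ≠ 0) {s : State} (h : InLoop M sp qi mem out v D g s) (hpc : s.pc = 40)
    (hi : s.reg 3 = i) (hc : s.reg 4 = c) (hx : s.rreg 5 = g u) :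
    value sampler M.input (.ofReal κ) F k s ≤
      .ofReal (κ * (6 + M.loopCost v g) + condExp M.w g (M.checkMean v B c u l)) := by
  let b : Fin 2 := if 0 < g u then 1 else 0
  have h1 : 0 < s.rreg 5 → b = 1 := fun h => if_pos (hx ▸ h)
  have h0 : s.rreg 5 < 0 → b = 0 := fun h => if_neg (not_lt.2 (hx ▸ h).le)
  have hb : ∀ σ : Fin n → Fin 2, Agrees g σ → σ u = b := by
    intro σ hσ
    rcases lt_or_gt_of_ne hu with h | h
    · rw [(hσ u).2 h, h0 (hx ▸ h)]
    · rw [(hσ u).1 h, h1 (hx ▸ h)]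
  have hL := mul_nonneg hκ (M.loopCost_nonneg hM v g)
  by_cases hacc : M.Accepts c b
  · have he : condExp M.w g (M.checkMean v B c u l) = condExp M.w g (M.roundMean v B c l) :=
      condExp_congr fun σ hσ => by
        unfold Model.checkMean
        rw [hb σ hσ, if_pos hacc]
    rw [he]
    refine (reaches_pass h hpc hc (hx ▸ hu) h1 h0 hacc).value_le hκ
      (add_nonneg hL (condExp_nonneg hM.w_nonneg fun σ => hM.roundMean_nonneg v hB c l σ)) ?_
      fun s' hs' => hedge s' hs'.1 hs'.2.1 (by rw [hs'.2.2.1, hi]) hs'.2.2.2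
    push_cast
    linarith
  · have he : condExp M.w g (M.checkMean v B c u l) = condExp M.w g (M.localMean v B) :=
      condExp_congr fun σ hσ => by
        unfold Model.checkMean
        rw [hb σ hσ, if_neg hacc]
    rw [he]
    refine (reaches_reject h hpc hc (hx ▸ hu) h1 h0 hacc).value_le hκ
      (add_nonneg hL (condExp_nonneg hM.w_nonneg fun σ => hM.localMean_nonneg v hB σ)) ?_
      fun s' hs' => hloop s' hs'.1 hs'.2
    push_cast
    linarith

/-- The recursive call is used in continuation style: `B'` is the bound for the rest of the
computation as a function of the returned spin. Averaging `B'` over the conditional law of that spin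
gives the claim by the tower property. -/
theorem reveal_bound (hM : M.Good) (hκ : 0 ≤ κ) (hS : SampleBound M κ F k) {sp qi : ℕ}
    {mem : ℕ → ℕ} {out : ℕ → Option ℕ} {v u : Fin n} {D : ℝ} (hD : 0 < D) {g : ℕ → ℝ}
    {B : Fin 2 → ℝ} (hB : ∀ b, 0 ≤ B b) {c : Fin 2} {l : List (Fin n)}
    (hadj : u ∈ M.adj v) (hu : g u = 0) (hg : ∀ m, |g m| ≤ D) (hval : M.Valid g) {s : State}
    (hcheck : ∀ b, 0 < M.lam u b → ∀ s', InLoop M sp qi mem out v D (Function.update g u (pin D b)) s' →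
      s'.pc = 40 → s'.reg 3 = s.reg 3 → s'.reg 4 = s.reg 4 → s'.rreg 5 = pin D b →
      value sampler M.input (.ofReal κ) F k s' ≤
        .ofReal (κ * (6 + M.loopCost v (Function.update g u (pin D b))) +
          condExp M.w (Function.update g u (pin D b)) (M.checkMean v B c u l)))
    (h : InLoop M sp qi mem out v D g s) (hpc : s.pc = 27) (hlt : ¬ s.rreg 7 < M.slack)
    (hi : s.reg 3 < (M.adj v).length) (hui : (M.adj v)[s.reg 3] = u) :
    value sampler M.input (.ofReal κ) F k s ≤
      .ofReal (κ * (32 + (M.callCost + M.loopCost v g - M.callCost * M.revealRate)) +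
        condExp M.w g (M.checkMean v B c u l)) := by
  set L := M.loopCost v g - M.callCost * M.revealRate with hL
  have hupd : ∀ b, M.loopCost v (Function.update g u (pin D b)) = L := fun b =>
    hM.loopCost_update hadj hu (pin_ne_zero hD b)
  have hL0 : 0 ≤ L := hupd 0 ▸ M.loopCost_nonneg hM v _
  -- 19 = 4 + 9 + 6: pinning, popping the frame, comparing.
  set B' : Fin 2 → ℝ := fun b => κ * (19 + L) +
    condExp M.w (Function.update g u (pin D b)) (M.checkMean v B c u l) with hB'
  have hE : ∀ g', 0 ≤ condExp M.w g' (M.checkMean v B c u l) := fun g' =>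
    condExp_nonneg hM.w_nonneg fun σ => hM.checkMean_nonneg v hB c u l σ
  have hB0 : ∀ b, 0 ≤ B' b := fun b =>
    add_nonneg (mul_nonneg hκ (by linarith)) (hE _)
  have hsum : condExp M.w g (fun σ => B' (σ u)) =
      κ * (19 + L) + condExp M.w g (M.checkMean v B c u l) := by
    rw [hB', condExp_add, condExp_const (hM.sum_pinned_pos hval), condExp_reveal hM.w_nonneg hu hD]
  refine (reaches_call h hpc hlt hi (by rw [hui]; exact hu)).value_le (k := k) hκ
    (x := κ * M.callCost + condExp M.w g (fun σ => B' (σ u))) ?_ ?_ ?_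
  · exact add_nonneg (mul_nonneg hκ M.callCost_pos.le)
      (condExp_nonneg hM.w_nonneg fun σ => hB0 _)
  · rw [hsum]
    push_cast
    linarith
  rintro s1 ⟨hb1, hpc1, hv1, hD1, hg1⟩
  refine hS hD hg hu hval hB0 ?_ s1 hb1 hpc1 (by rw [hv1, hui]) hD1 hg1
  intro b hb s2 hb2 hpc2 hv2 hc2 hD2 hg2
  refine (reaches_pinned hb2 hpc2 hv2 hc2).value_le (k := k) hκ
    (x := κ * (15 + L) + condExp M.w (Function.update g u (pin D b)) (M.checkMean v B c u l))
    (add_nonneg (mul_nonneg hκ (by linarith)) (hE _)) (by push_cast; linarith) ?_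
  rintro s3 ⟨hb3, hpc3, -, -, hD3, hg3, hx3⟩
  rw [hD2] at hD3
  rw [hD2, hg2] at hg3
  rw [hD2] at hx3
  refine (reaches_pop h.stack hb3 hpc3).value_le (k := k) hκ
    (x := κ * (6 + L) + condExp M.w (Function.update g u (pin D b)) (M.checkMean v B c u l))
    (add_nonneg (mul_nonneg hκ (by linarith)) (hE _)) (by push_cast; linarith) ?_
  rintro s4 ⟨h4, hpc4, hi4, hc4, hx4⟩
  rw [hD3, hg3] at h4
  rw [← hupd b]
  exact hcheck b hb s4 h4 hpc4 hi4 hc4 (hx4.trans hx3)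

/-- Induction on the edges still to be examined. The pins are generalised because a reveal changes
them in the middle of a round. -/
theorem edge_bound (hM : M.Good) (hκ : 0 ≤ κ) (hS : SampleBound M κ F k) (hL : LoopBound M κ F k)
    {sp qi : ℕ} {mem : ℕ → ℕ} {out : ℕ → Option ℕ} {v : Fin n} {f : ℕ → ℝ} {D : ℝ} {B : Fin 2 → ℝ}
    (hD : 0 < D) (hf : ∀ m, |f m| < D) (hB : ∀ b, 0 ≤ B b)
    (hacc : AcceptBound M κ F k sp qi mem out v f D B) {c : Fin 2} (hc : 0 < M.lam v c)
    (l : List (Fin n)) (i : ℕ) (hl : (M.adj v).drop i = l) (g : ℕ → ℝ) (s : State)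
    (hg : LoopPins (M.adj v) f D g) (hval : M.Valid g) (h : InLoop M sp qi mem out v D g s)
    (hpc : s.pc = 24) (h3 : s.reg 3 = i) (h4 : s.reg 4 = c) :
    value sampler M.input (.ofReal κ) F k s ≤
      .ofReal (κ * M.edgeCost v g l + condExp M.w g (M.roundMean v B c l)) := by
  induction l generalizing i g s with
  | nil =>
    have he : condExp M.w g (M.roundMean v B c []) = B c := by
      rw [← condExp_const (hM.sum_pinned_pos hval) (B c)]
      congr 1
      funext σ
      simp [Model.roundMean, Model.passAll]
    have hlen : (M.adj v).length ≤ s.reg 3 := by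
      rw [h3]; exact List.drop_eq_nil_iff.1 hl
    rw [he]
    refine (reaches_accept h hpc hlen).value_le hκ (hB c) ?_
      fun s' hs' => hacc c hc g s' hg hs'.1 hs'.2.1 (hs'.2.2.trans h4)
    have : M.edgeCost v g [] = 40 := by simp [Model.edgeCost, Model.free]
    rw [this]
    push_cast
    linarith
  | cons u l ih =>
    have hi : i < (M.adj v).length := by
      by_contra hcon
      rw [List.drop_eq_nil_iff.2 (not_lt.1 hcon)] at hl
      cases hl
    rw [List.drop_eq_getElem_cons hi, List.cons.injEq] at hl
    obtain ⟨hui, hl⟩ := hl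
    have hadj : u ∈ M.adj v := hui ▸ List.getElem_mem hi
    -- the continuation after the constraint of `u` has been examined
    have hchk : ∀ g', LoopPins (M.adj v) f D g' → M.Valid g' → g' u ≠ 0 → ∀ s',
        InLoop M sp qi mem out v D g' s' → s'.pc = 40 → s'.reg 3 = i → s'.reg 4 = c →
        s'.rreg 5 = g' u → value sampler M.input (.ofReal κ) F k s' ≤
          .ofReal (κ * (6 + M.loopCost v g') + condExp M.w g' (M.checkMean v B c u l)) := by
      intro g' hg' hval' hu' s' hs' hpc' hi' hc' hx'
      refine check_bound hM hκ hB (fun s hs hp => hL hD hf hB hacc g' s hg' hval' hs hp)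
        (fun s hs hp hr3 hr4 => (ih (i + 1) hl g' s hg' hval' hs hp hr3 hr4).trans ?_)
        hu' hs' hpc' hi' hc' hx'
      refine ENNReal.ofReal_le_ofReal ?_
      have := mul_le_mul_of_nonneg_left (hM.edgeCost_le_loopCost v g' (i + 1)) hκ
      rw [hl] at this
      linarith
    -- `Y` is the budget after the edge has made its demand; the two cases are a free neighbour,
    -- which must be sampled, and a pinned one.
    obtain ⟨Y, hY0, hY, hYb⟩ : ∃ Y, 0 ≤ Y ∧ 40 + M.slack * M.edgeCost v g l + (1 - M.slack) * Y ≤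
        M.edgeCost v g (u :: l) ∧ ∀ s', InLoop M sp qi mem out v D g s' → s'.pc = 27 →
        ¬ s'.rreg 7 < M.slack → s'.reg 3 = i → s'.reg 4 = c →
        value sampler M.input (.ofReal κ) F k s' ≤
          .ofReal (κ * (32 + Y) + condExp M.w g (M.checkMean v B c u l)) := by
      by_cases hu : g u = 0
      · have hpos : 0 ≤ M.callCost + M.loopCost v g - M.callCost * M.revealRate := by
          have h1 := M.callCost_pos
          have h2 := hM.revealRate_lt_one
          have h3 := M.loopCost_nonneg hM v g
          nlinarith
        refine ⟨_, hpos, hM.edgeCost_cons_of_eq v hu l, ?_⟩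
        intro s' hs' hpc' hlt' hr3 hr4
        refine reveal_bound hM hκ hS hD hB hadj hu (hg.abs_le hf) hval ?_ hs' hpc' hlt'
          (hr3 ▸ hi) (by simpa only [hr3] using hui)
        intro b hb s'' hs'' hpc'' hi'' hc'' hx''
        exact hchk _ (hg.update hD hadj hu b) (hval.update hb hD)
          (by rw [Function.update_self]; exact pin_ne_zero hD b) s'' hs'' hpc''
          (hi''.trans hr3) (hc''.trans hr4) (by rw [hx'', Function.update_self])
      · refine ⟨_, M.loopCost_nonneg hM v g, hM.edgeCost_cons_of_ne v hu l, ?_⟩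
        intro s' hs' hpc' hlt' hr3 hr4
        have hui' : (M.adj v)[s'.reg 3]'(hr3 ▸ hi) = u := by simpa only [hr3] using hui
        refine (reaches_check hs' hpc' hlt' (hr3 ▸ hi) (by rw [hui']; exact hu)).value_le
          (x := κ * (6 + M.loopCost v g) + condExp M.w g (M.checkMean v B c u l)) hκ ?_ ?_ ?_
        · have := M.loopCost_nonneg hM v g
          exact add_nonneg (by positivity)
            (condExp_nonneg hM.w_nonneg fun σ => hM.checkMean_nonneg v hB c u l σ)
        · push_cast
          linarith
        · rintro s'' ⟨hs'', hpc'', hi'', hc'', hx''⟩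
          exact hchk g hg hval hu s'' hs'' hpc'' (hi''.trans hr3) (hc''.trans hr4)
            (by rw [hx'', hui'])
    have hE1 := condExp_nonneg (g := g) hM.w_nonneg fun σ => hM.roundMean_nonneg v hB c l σ
    have hE2 := condExp_nonneg (g := g) hM.w_nonneg fun σ => hM.checkMean_nonneg v hB c u l σ
    have hp0 := hM.slack_pos
    have hp1 := hM.slack_le_one
    have he0 := hM.edgeCost_nonneg v g l
    set a := κ * (3 + M.edgeCost v g l) + condExp M.w g (M.roundMean v B c l)
    set b := κ * (32 + Y) + condExp M.w g (M.checkMean v B c u l)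
    have ha : 0 ≤ a := by positivity
    have hb : 0 ≤ b := by positivity
    have hmean : condExp M.w g (M.roundMean v B c (u :: l)) =
        M.slack * condExp M.w g (M.roundMean v B c l) +
          (1 - M.slack) * condExp M.w g (M.checkMean v B c u l) := by
      rw [← condExp_const_mul, ← condExp_const_mul, ← condExp_add]
      congr 1
      funext σ
      exact Model.roundMean_cons v B c u l σ
    have hq : 0 ≤ 1 - M.slack := by linarith
    refine (reaches_coin h hpc (h3 ▸ hi)).value_le hκ
      (x := κ + (M.slack * a + (1 - M.slack) * b)) (by positivity) ?_ ?_
    · have h5 := mul_le_mul_of_nonneg_left hY hκ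
      rw [hmean]
      have h6 : 0 ≤ κ * M.slack := by positivity
      push_cast
      simp only [a, b]
      linarith
    · rintro s1 ⟨hs1, hpc1, hi1, hc1⟩
      refine (value_le_succ k s1).trans ?_
      refine value_succ_le_of_rand (i := 7) (by rw [hpc1]; rfl) hκ hp0.le hp1 ha hb le_rfl ?_ ?_
      · intro x _ hx
        refine (reaches_skip (hs1.setReal_seven x) (by simp [State.setReal, hpc1])
          (by simpa [State.setReal] using hx)).value_le hκ
          (x := κ * M.edgeCost v g l + condExp M.w g (M.roundMean v B c l)) (by positivity)
          (by simp only [a]; push_cast; linarith) ?_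
        rintro s2 ⟨hs2, hpc2, hi2, hc2⟩
        refine ih (i + 1) hl g s2 hg hval hs2 hpc2 ?_ ?_
        · rw [hi2]; simp [State.setReal, hi1, h3]
        · rw [hc2]; simp [State.setReal, hc1, h4]
      · intro x hx _
        refine hYb _ (hs1.setReal_seven x) (by simp [State.setReal, hpc1])
          (by simpa [State.setReal] using hx) ?_ ?_
        · simp [State.setReal, hi1, h3]
        · simp [State.setReal, hc1, h4]

/-- The random draw of the proposal uses one unit of the cut-off. This is why restarts and nested
calls may be handled by the bounds for `k`. -/
theorem loopBound_succ (hM : M.Good) (hκ : 0 ≤ κ) (hS : SampleBound M κ F k)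
    (hL : LoopBound M κ F k) : LoopBound M κ F (k + 1) := by
  intro sp qi mem out v f D B hD hf hB hacc g s hg hval h hpc
  have hsum := hM.sum_lam_pos v
  have hl0 := hM.lam_nonneg v 0
  have hl1 := hM.lam_nonneg v 1
  set q := M.lam v 0 / (M.lam v 0 + M.lam v 1) with hq
  have hq0 : 0 ≤ q := by positivity
  have hq1 : q ≤ 1 := by rw [hq, div_le_one hsum]; linarith
  have he0 := hM.edgeCost_nonneg v g (M.adj v)
  have hE : ∀ c, 0 ≤ condExp M.w g (M.roundMean v B c (M.adj v)) := fun c =>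
    condExp_nonneg hM.w_nonneg fun σ => hM.roundMean_nonneg v hB c _ σ
  set a : Fin 2 → ℝ := fun c =>
    κ * (5 + M.edgeCost v g (M.adj v)) + condExp M.w g (M.roundMean v B c (M.adj v)) with ha
  have ha0 : ∀ c, 0 ≤ a c := fun c => add_nonneg (by positivity) (hE c)
  have hmean : condExp M.w g (M.localMean v B) =
      q * condExp M.w g (M.roundMean v B 0 (M.adj v)) +
        (1 - q) * condExp M.w g (M.roundMean v B 1 (M.adj v)) := by
    rw [← condExp_const_mul, ← condExp_const_mul, ← condExp_add]
    congr 1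
    funext σ
    exact (hM.localMean_eq v B σ).symm
  have hq' : 0 ≤ 1 - q := by linarith
  have hround : ∀ c, 0 < M.lam v c → ∀ s', InLoop M sp qi mem out v D g s' → s'.pc = 24 →
      s'.reg 3 = 0 → s'.reg 4 = c → value sampler M.input (.ofReal κ) F k s' ≤
        .ofReal (κ * M.edgeCost v g (M.adj v) + condExp M.w g (M.roundMean v B c (M.adj v))) :=
    fun c hc s' hs' hpc' h3' h4' => edge_bound hM hκ hS hL hD hf hB hacc.of_succ hc (M.adj v) 0 rfl
      g s' hg hval hs' hpc' h3' h4'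
  refine (reaches_fields h hpc).value_le hκ (x := κ + (q * a 0 + (1 - q) * a 1))
    (add_nonneg hκ (add_nonneg (mul_nonneg hq0 (ha0 0)) (mul_nonneg hq' (ha0 1)))) ?_ ?_
  · have h5 := mul_le_mul_of_nonneg_left (hM.add_edgeCost_le_loopCost v g) hκ
    rw [hmean]
    simp only [ha]
    push_cast
    linarith
  rintro s1 ⟨hs1, hpc1, hx1, hy1⟩
  refine value_succ_le_of_rand (i := 7) (by rw [hpc1]; rfl) hκ hq0 hq1 (ha0 0) (ha0 1) le_rfl ?_ ?_
  · intro x hx0 hx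
    have hpos : 0 < M.lam v 0 := by
      rcases hl0.eq_or_lt with h0 | h0
      · rw [hq, ← h0, zero_div] at hx; linarith
      · exact h0
    rw [hq, lt_div_iff₀ hsum] at hx
    refine (reaches_propose_zero (hs1.setReal_seven x) (by simp [State.setReal, hpc1])
      (by simpa [State.setReal, hx1, hy1] using hx)).value_le hκ
      (x := κ * M.edgeCost v g (M.adj v) + condExp M.w g (M.roundMean v B 0 (M.adj v)))
      (add_nonneg (by positivity) (hE 0)) (by simp only [ha]; push_cast; linarith) ?_
    rintro s2 ⟨hs2, hpc2, hi2, hc2⟩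
    exact hround 0 hpos s2 hs2 hpc2 hi2 hc2
  · intro x hx hx1'
    -- If this field vanished, q would be 1 and no draw would lie in [q, 1).
    have hpos : 0 < M.lam v 1 := by
      rcases hl1.eq_or_lt with h0 | h0
      · rw [← h0, add_zero] at hsum
        rw [hq, ← h0, add_zero, div_self hsum.ne'] at hx
        linarith
      · exact h0
    rw [hq, div_le_iff₀ hsum] at hx
    refine (reaches_propose_one (hs1.setReal_seven x) (by simp [State.setReal, hpc1])
      (by simpa [State.setReal, hx1, hy1] using hx)).value_le hκ
      (x := κ * M.edgeCost v g (M.adj v) + condExp M.w g (M.roundMean v B 1 (M.adj v)))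
      (add_nonneg (by positivity) (hE 1)) (by simp only [ha]; push_cast; linarith) ?_
    rintro s2 ⟨hs2, hpc2, hi2, hc2⟩
    exact hround 1 hpos s2 hs2 hpc2 hi2 hc2

/-- The invariant is `LoopPins` for the neighbours not yet visited; when none is left, the pins are
again those before the call. -/
theorem unpin_bound (hκ : 0 ≤ κ) {sp qi : ℕ} {mem : ℕ → ℕ} {out : ℕ → Option ℕ}
    {v : Fin n} {f : ℕ → ℝ} {D : ℝ} (hD : 0 < D) (hf : ∀ m, |f m| < D) {b : Fin 2} {y : ℝ}
    (hy : 0 ≤ y)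
    (hret : ∀ s, Base M sp qi mem out s → s.pc = 59 → s.reg 2 = v → s.reg 4 = b →
      s.rreg 4 = D - 1 → s.rmem = f → value sampler M.input (.ofReal κ) F k s ≤ .ofReal y)
    (l : List (Fin n)) (i : ℕ) (hl : (M.adj v).drop i = l) (g : ℕ → ℝ) (s : State)
    (hg : LoopPins l f D g) (h : InLoop M sp qi mem out v D g s) (hpc : s.pc = 49)
    (h3 : s.reg 3 = i) (h4 : s.reg 4 = b) (h6 : s.rreg 6 = D * D) :
    value sampler M.input (.ofReal κ) F k s ≤ .ofReal (κ * (3 + 8 * l.length) + y) := by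
  induction l generalizing i g s with
  | nil =>
    have hlen : (M.adj v).length ≤ s.reg 3 := by
      rw [h3]; exact List.drop_eq_nil_iff.1 hl
    have hgf : g = f := funext fun m => (hg m).resolve_right (by simp)
    refine (reaches_leave h hpc hlen).value_le hκ hy (by simp) ?_
    rintro s' ⟨hs', hpc', hv', hc', hD', hg'⟩
    exact hret s' hs' hpc' hv' (hc'.trans h4) hD' (hg'.trans hgf)
  | cons u l ih =>
    have hi : i < (M.adj v).length := by
      by_contra hcon
      rw [List.drop_eq_nil_iff.2 (not_lt.1 hcon)] at hl
      cases hl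
    rw [List.drop_eq_getElem_cons hi, List.cons.injEq] at hl
    obtain ⟨hui, hl⟩ := hl
    have hi' : s.reg 3 < (M.adj v).length := h3 ▸ hi
    have hui' : (M.adj v)[s.reg 3] = u := by simpa only [h3] using hui
    have hsq : g u * g u < D * D ↔ |g u| < D := by
      rw [← abs_mul_abs_self (g u)]
      exact ⟨fun hlt => lt_of_mul_self_lt_mul_self₀ hD.le hlt,
        fun hlt => mul_self_lt_mul_self (abs_nonneg _) hlt⟩
    have hx : 0 ≤ κ * (3 + 8 * (l.length : ℝ)) + y := by positivity
    have hle : κ * (8 : ℕ) + (κ * (3 + 8 * (l.length : ℝ)) + y) ≤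
        κ * (3 + 8 * ((u :: l).length : ℝ)) + y := by
      rw [List.length_cons]; push_cast; linarith
    by_cases hlt : g u * g u < D * D
    · refine (reaches_keep h hpc hi' h6 (by rw [hui']; exact hlt)).value_le hκ hx hle ?_
      rintro s' ⟨hs', hpc', hi'', hc', h6'⟩
      refine ih (i + 1) hl g s' (fun m => ?_) hs' hpc' (by rw [hi'', h3]) (hc'.trans h4) h6'
      rcases hg m with h | ⟨h1, h2, x, hx, rfl⟩
      · exact Or.inl h
      · rcases List.mem_cons.1 hx with rfl | hx
        · exact absurd h2 (hsq.1 hlt).ne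
        · exact Or.inr ⟨h1, h2, x, hx, rfl⟩
    · refine (reaches_unpin h hpc hi' h6 (by rw [hui']; exact hlt)).value_le hκ hx hle ?_
      rintro s' ⟨hs', hpc', hi'', hc', h6'⟩
      rw [hui'] at hs'
      refine ih (i + 1) hl _ s' (fun m => ?_) hs' hpc' (by rw [hi'', h3]) (hc'.trans h4) h6'
      -- Pins of `f` are smaller than `D`, so a pin that fails the test was made in this loop.
      have hfu : f u = 0 := by
        rcases hg u with h | h
        · exact absurd (h ▸ hf u) (mt hsq.2 hlt)
        · exact h.1
      by_cases hm : m = u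
      · subst hm
        exact Or.inl (by rw [Function.update_self, hfu])
      · rw [Function.update_of_ne hm]
        rcases hg m with h | ⟨h1, h2, x, hx, rfl⟩
        · exact Or.inl h
        · rcases List.mem_cons.1 hx with rfl | hx
          · exact absurd rfl hm
          · exact Or.inr ⟨h1, h2, x, hx, rfl⟩

/-- Entry and clean-up are deterministic, so the cut-off stays the same. Since `v` is free in `f`,
the local mean can be replaced by the conditional law of its spin. -/
theorem LoopBound.sampleBound (hM : M.Good) (hκ : 0 ≤ κ) (hL : LoopBound M κ F k) :
    SampleBound M κ F k := by
  intro sp qi mem out v f D B hD hf hv hval hB hret s hs hpc hv2 hD4 hpins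
  -- 2 steps to set up the clean-up, 8 for each neighbour and 3 to leave.
  set e : ℝ := 5 + 8 * ((M.adj v).length : ℝ) with he
  have he0 : 0 ≤ e := by positivity
  have hD1 : 0 < D + 1 := by linarith
  have hf1 : ∀ m, |f m| < D + 1 := fun m => (hf m).trans_lt (by linarith)
  have hB' : ∀ b, 0 ≤ κ * e + B b := fun b => add_nonneg (by positivity) (hB b)
  have hacc : AcceptBound M κ F k sp qi mem out v f (D + 1) fun b => κ * e + B b := by
    intro b hb g s hg h hpc h4
    refine (reaches_cleanup h hpc).value_le hκ
      (x := κ * (3 + 8 * ((M.adj v).length : ℝ)) + B b)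
      (add_nonneg (by positivity) (hB b)) (by simp only [he]; push_cast; linarith) ?_
    rintro s' ⟨hs', hpc', hi', hc', h6'⟩
    refine unpin_bound hκ hD1 hf1 (hB b) ?_ (M.adj v) 0 rfl g s' hg hs' hpc' hi' (hc'.trans h4) h6'
    intro s'' hs'' hpc'' hv'' hc'' hD'' hg''
    exact hret b hb s'' hs'' hpc'' hv'' hc'' (by rw [hD'']; ring) hg''
  have hmean : condExp M.w f (M.localMean v fun b => κ * e + B b) =
      κ * e + condExp M.w f (fun σ => B (σ v)) := by
    rw [hM.condExp_localMean hv, condExp_add, condExp_const (hM.sum_pinned_pos hval)]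
  refine (reaches_enter hs hpc hv2).value_le hκ
    (x := κ * M.loopCost v f + condExp M.w f (M.localMean v fun b => κ * e + B b)) ?_ ?_ ?_
  · exact add_nonneg (mul_nonneg hκ (M.loopCost_nonneg hM v f))
      (condExp_nonneg hM.w_nonneg fun σ => hM.localMean_nonneg v hB' σ)
  · have hlen : ((M.adj v).length : ℝ) ≤ M.Δ := by exact_mod_cast hM.length_le v
    have h1 := hM.loopCost_le_callCost v f
    have hΔ := hM.one_le_degree
    have h2 : 2 + (M.loopCost v f + e) ≤ M.callCost := by linarith
    have h3 := mul_le_mul_of_nonneg_left h2 hκ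
    rw [hmean]
    push_cast
    linarith
  · rintro s' ⟨hs', hpc'⟩
    rw [hD4, hpins] at hs'
    exact hL hD1 hf1 hB' hacc f s' (fun m => Or.inl rfl) hval hs' hpc'

theorem sampleBound (hM : M.Good) (hκ : 0 ≤ κ) (F : State → ℝ≥0∞) (k : ℕ) :
    SampleBound M κ F k := by
  have h : ∀ k, LoopBound M κ F k := by
    intro k
    induction k with
    | zero =>
      intro sp qi mem out v f D B _ _ _ _ g s _ _ _ _
      exact zero_le
    | succ k ih => exact loopBound_succ hM hκ (ih.sampleBound hM hκ) ih
  exact (h k).sampleBound hM hκ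

end

/-! ### The sequence of queries and the law of the output -/

section

variable {n : ℕ} {M : Model n} {κ : ℝ} {F : State → ℝ≥0∞} {k : ℕ}

theorem exists_agrees {w : (Fin n → Fin 2) → ℝ} {g : ℕ → ℝ} (hZ : 0 < ∑ σ, pinned w g σ) :
    ∃ σ : Fin n → Fin 2, Agrees g σ := by
  by_contra hcon
  push Not at hcon
  refine hZ.ne' (Finset.sum_eq_zero fun σ _ => if_neg (hcon σ))

theorem le_condExp {w : (Fin n → Fin 2) → ℝ} (hw : ∀ σ, 0 ≤ w σ) {g : ℕ → ℝ}
    (hZ : 0 < ∑ σ, pinned w g σ) {B : (Fin n → Fin 2) → ℝ} {t : ℝ}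
    (h : ∀ σ, Agrees g σ → t ≤ B σ) : t ≤ condExp w g B := by
  unfold condExp
  rw [le_div_iff₀ hZ, Finset.mul_sum]
  refine Finset.sum_le_sum fun σ _ => ?_
  by_cases hσ : Agrees g σ
  · rw [mul_comm]
    exact mul_le_mul_of_nonneg_left (h σ hσ) (pinned_nonneg hw g σ)
  · simp [pinned, hσ]

/-- Answered queries keep their pins, of absolute value 1, so each query is sampled conditional on
the earlier answers and the joint law comes out by the tower property. `Nodup` guarantees that the
next query is still free. -/
theorem query_bound (hM : M.Good) (hκ : 0 ≤ κ) (hnodup : M.query.Nodup)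
    {B : (Fin n → Fin 2) → ℝ} (hB : ∀ σ, 0 ≤ B σ)
    (hF : ∀ s (σ : Fin n → Fin 2), (∀ u ∈ M.query, s.out u = some ((σ u : Fin 2) : ℕ)) →
      (∀ m, (∀ u ∈ M.query, (u : ℕ) ≠ m) → s.out m = none) → F s ≤ .ofReal (B σ))
    (l : List (Fin n)) (j : ℕ) (hl : M.query.drop j = l) (mem : ℕ → ℕ) (out : ℕ → Option ℕ)
    (g : ℕ → ℝ) (s : State) (hg : ∀ m, |g m| ≤ 1) (hval : M.Valid g)
    (hpin : ∀ m, g m ≠ 0 ↔ ∃ u ∈ M.query.take j, (u : ℕ) = m)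
    (hout : ∀ m, out m = if g m = 0 then none else some (if 0 < g m then 1 else 0))
    (h : Base M 0 j mem out s) (hpc : s.pc = 9) (h4 : s.rreg 4 = 1) (hpins : s.rmem = g) :
    value sampler M.input (.ofReal κ) F k s ≤
      .ofReal (κ * (3 + (M.callCost + 20) * l.length) + condExp M.w g B) := by
  induction l generalizing j mem out g s with
  | nil =>
    have hlen : M.query.length ≤ j := List.drop_eq_nil_iff.1 hl
    rw [List.take_of_length_le hlen] at hpin
    refine (reaches_halt h hpc hlen).value_le hκ
      (condExp_nonneg (g := g) hM.w_nonneg hB) (by simp [mul_comm]) ?_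
    rintro s' ⟨hhalt, hout'⟩
    refine (value_le_succ k s').trans ?_
    rw [value_halted hhalt]
    have key : ∀ σ : Fin n → Fin 2, Agrees g σ → F s' ≤ .ofReal (B σ) := by
      intro σ hσ
      refine hF s' σ (fun u hu => ?_) fun m hm => ?_
      · have hne : g u ≠ 0 := (hpin u).2 ⟨u, hu, rfl⟩
        rw [hout', hout, if_neg hne]
        rcases lt_or_gt_of_ne hne with hlt | hgt
        · rw [(hσ u).2 hlt, if_neg (not_lt.2 hlt.le)]; rfl
        · rw [(hσ u).1 hgt, if_pos hgt]; rfl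
      · have h0 : g m = 0 := by
          by_contra hne
          obtain ⟨u, hu, rfl⟩ := (hpin m).1 hne
          exact hm u hu rfl
        rw [hout', hout, if_pos h0]
    -- One compatible configuration shows that the final reward is finite, so it can be treated as a
    -- real lower bound for `B` under the average.
    obtain ⟨σ₀, hσ₀⟩ := exists_agrees (hM.sum_pinned_pos hval)
    have hfin : F s' ≠ ⊤ := ne_top_of_le_ne_top ENNReal.ofReal_ne_top (key σ₀ hσ₀)
    rw [← ENNReal.ofReal_toReal hfin]
    refine ENNReal.ofReal_le_ofReal (le_condExp hM.w_nonneg (hM.sum_pinned_pos hval) fun σ hσ => ?_)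
    exact ENNReal.toReal_le_of_le_ofReal (hB σ) (key σ hσ)
  | cons v l ih =>
    have hj : j < M.query.length := by
      by_contra hcon
      rw [List.drop_eq_nil_iff.2 (not_lt.1 hcon)] at hl
      cases hl
    have hdisj := List.disjoint_take_drop hnodup (le_refl j)
    rw [hl] at hdisj
    rw [List.drop_eq_getElem_cons hj, List.cons.injEq] at hl
    obtain ⟨hvj, hl⟩ := hl
    have hgv : g v = 0 := by
      by_contra hne
      obtain ⟨u, hu, huv⟩ := (hpin v).1 hne
      rw [Fin.ext huv] at hu
      exact hdisj hu List.mem_cons_self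
    have hC := M.callCost_pos
    have hE : ∀ g', 0 ≤ condExp M.w g' B := fun g' => condExp_nonneg hM.w_nonneg hB
    set B' : Fin 2 → ℝ := fun b => κ * (11 + (M.callCost + 20) * l.length) +
      condExp M.w (Function.update g v (pin 1 b)) B with hB'
    have hB0 : ∀ b, 0 ≤ B' b := fun b => add_nonneg (by positivity) (hE _)
    have hsum : condExp M.w g (fun σ => B' (σ v)) =
        κ * (11 + (M.callCost + 20) * l.length) + condExp M.w g B := by
      rw [hB', condExp_add, condExp_const (hM.sum_pinned_pos hval),
        condExp_reveal hM.w_nonneg hgv one_pos]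
    refine (reaches_query h hpc hj).value_le hκ
      (x := κ * M.callCost + condExp M.w g (fun σ => B' (σ v))) ?_ ?_ ?_
    · exact add_nonneg (by positivity) (condExp_nonneg hM.w_nonneg fun σ => hB0 _)
    · rw [hsum, List.length_cons]
      push_cast
      linarith
    rintro s1 ⟨hs1, hpc1, hv1, hD1, hg1⟩
    refine sampleBound hM hκ F k one_pos hg hgv hval hB0 ?_ s1 hs1 hpc1 (by rw [hv1, hvj])
      (hD1.trans h4) (hg1.trans hpins)
    intro b hb s2 hs2 hpc2 hv2 hc2 hD2 hg2
    refine (reaches_pinned hs2 hpc2 hv2 hc2).value_le hκ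
      (x := κ * (7 + (M.callCost + 20) * l.length) +
        condExp M.w (Function.update g v (pin 1 b)) B)
      (add_nonneg (by positivity) (hE _)) (by simp only [hB']; push_cast; linarith) ?_
    rintro s3 ⟨hs3, hpc3, hv3, hc3, hD3, hg3, -⟩
    refine (reaches_output hs3 hpc3).value_le hκ
      (x := κ * (3 + (M.callCost + 20) * l.length) +
        condExp M.w (Function.update g v (pin 1 b)) B)
      (add_nonneg (by positivity) (hE _)) (by push_cast; linarith) ?_
    rintro s4 ⟨hs4, hpc4, hD4, hg4⟩
    rw [hD2, hg2] at hg3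
    refine ih (j + 1) hl mem _ _ s4 (fun m => ?_) (hval.update hb one_pos) (fun m => ?_)
      (fun m => ?_) hs4 hpc4 (by rw [hD4, hD3, hD2]) (hg4.trans hg3)
    · by_cases hm : m = v
      · rw [hm, Function.update_self, abs_pin one_pos]
      · rw [Function.update_of_ne hm]; exact hg m
    · rw [List.take_succ_eq_append_getElem hj, hvj]
      by_cases hm : m = v
      · subst hm
        rw [Function.update_self]
        simp [pin_ne_zero one_pos b]
      · rw [Function.update_of_ne hm, hpin]
        simp [Ne.symm hm]
    · rw [hv3, hc3]
      by_cases hm : m = v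
      · subst hm
        rw [Function.update_self, Function.update_self, if_neg (pin_ne_zero one_pos b)]
        congr 1
        simp only [pin_pos_iff one_pos]
        fin_cases b <;> rfl
      · rw [Function.update_of_ne hm, Function.update_of_ne hm, hout]

theorem start_bound (hM : M.Good) (hκ : 0 ≤ κ) (hnodup : M.query.Nodup)
    {B : (Fin n → Fin 2) → ℝ} (hB : ∀ σ, 0 ≤ B σ)
    (hF : ∀ s (σ : Fin n → Fin 2), (∀ u ∈ M.query, s.out u = some ((σ u : Fin 2) : ℕ)) →
      (∀ m, (∀ u ∈ M.query, (u : ℕ) ≠ m) → s.out m = none) → F s ≤ .ofReal (B σ)) (k : ℕ) :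
    value sampler M.input (.ofReal κ) F k State.init ≤
      .ofReal (κ * (11 + (M.callCost + 20) * M.query.length) +
        (∑ σ, M.w σ * B σ) / ∑ σ, M.w σ) := by
  have hC := M.callCost_pos
  have hmean : condExp M.w (fun _ => 0) B = (∑ σ, M.w σ * B σ) / ∑ σ, M.w σ := by
    have : ∀ σ : Fin n → Fin 2, Agrees (fun _ => 0) σ := fun σ u => by simp
    simp [condExp, pinned, this]
  rw [← hmean]
  refine (reaches_start M).value_le hκ
    (x := κ * (3 + (M.callCost + 20) * M.query.length) + condExp M.w (fun _ => 0) B)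
    (add_nonneg (by positivity) (condExp_nonneg hM.w_nonneg hB)) (by push_cast; linarith) ?_
  rintro s ⟨hs, hpc, h4, hpins⟩
  exact query_bound hM hκ hnodup hB hF M.query 0 rfl _ _ _ s (by simp) (fun u => by simp)
    (by simp) (by simp) hs hpc h4 hpins

/-- The expected running time of the sampler. -/
theorem value_start_le (hM : M.Good) (hnodup : M.query.Nodup) (k : ℕ) :
    value sampler M.input 1 0 k State.init ≤
      .ofReal (11 + (M.callCost + 20) * M.query.length) := by
  have h := start_bound (κ := 1) (F := 0) hM zero_le_one hnodup (B := fun _ => 0)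
    (fun _ => le_rfl) (fun _ _ _ _ => zero_le) k
  simpa using h

open Classical in
/-- The output of the sampler on `Λ` has the law proportional to `w`. -/
theorem measure_outputs (hM : M.Good) (hnodup : M.query.Nodup) {Λ : Finset (Fin n)}
    (hquery : ∀ v, v ∈ M.query ↔ v ∈ Λ) (τ : Λ → Fin 2) :
    tapeMeasure {ω | Outputs sampler M.input τ ω} =
      .ofReal ((∑ σ, M.w σ * if ∀ v : Λ, σ v = τ v then 1 else 0) / ∑ σ, M.w σ) := by
  set S : Set State := {s | (∀ v : Λ, s.out (v : Fin n).val = some (τ v).val) ∧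
    ∀ m : ℕ, (∀ v ∈ Λ, v.val ≠ m) → s.out m = none} with hS
  have hSm : MeasurableSet S := by
    have hcoord : ∀ (m : ℕ) (o : Option ℕ), MeasurableSet {s : State | s.out m = o} :=
      fun m o => ((measurable_pi_apply m).comp measurable_out) (t := {o}) trivial
    have hS' : S = (⋂ v : Λ, {s | s.out (v : Fin n).val = some (τ v).val}) ∩
        ⋂ (m : ℕ) (_ : ∀ v ∈ Λ, v.val ≠ m), {s | s.out m = none} := by
      ext s; simp [hS]
    rw [hS']
    exact (MeasurableSet.iInter fun v => hcoord _ _).inter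
      (MeasurableSet.iInter fun m => MeasurableSet.iInter fun _ => hcoord _ _)
  set B : (Fin n → Fin 2) → ℝ := fun σ => if ∀ v : Λ, σ v = τ v then 1 else 0 with hB
  have hB0 : ∀ σ, 0 ≤ B σ := fun σ => by simp only [hB]; split_ifs <;> norm_num
  have hB1 : ∀ σ, 0 ≤ 1 - B σ := fun σ => by simp only [hB]; split_ifs <;> norm_num
  have hmem : ∀ (s : State) (σ : Fin n → Fin 2),
      (∀ u ∈ M.query, s.out u = some ((σ u : Fin 2) : ℕ)) →
      (∀ m, (∀ u ∈ M.query, (u : ℕ) ≠ m) → s.out m = none) →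
      (s ∈ S ↔ ∀ v : Λ, σ v = τ v) := by
    intro s σ h1 h2
    have e : ∀ v : Λ, s.out (v : Fin n).val = some (σ v).val := fun v => h1 v ((hquery v).2 v.2)
    constructor
    · intro hs v
      have := hs.1 v
      rw [e, Option.some.injEq] at this
      exact Fin.ext this
    · intro hσ
      refine ⟨fun v => by rw [e, hσ v], fun m hm => h2 m fun u hu => hm u ((hquery u).1 hu)⟩
  have hZ : 0 < ∑ σ, M.w σ := by
    choose d hd using hM.lam_pos
    exact Finset.sum_pos' (fun σ _ => hM.w_nonneg σ) ⟨d, Finset.mem_univ d, hM.w_pos d hd⟩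
  set p : ℝ := (∑ σ, M.w σ * B σ) / ∑ σ, M.w σ with hp
  have hcompl : (∑ σ, M.w σ * (1 - B σ)) / ∑ σ, M.w σ = 1 - p := by
    simp only [hp, mul_sub, mul_one, Finset.sum_sub_distrib, sub_div, div_self hZ.ne']
  have hp0 : 0 ≤ p :=
    div_nonneg (Finset.sum_nonneg fun σ _ => mul_nonneg (hM.w_nonneg σ) (hB0 σ)) hZ.le
  have hp1 : 0 ≤ 1 - p := by
    rw [← hcompl]
    exact div_nonneg (Finset.sum_nonneg fun σ _ => mul_nonneg (hM.w_nonneg σ) (hB1 σ)) hZ.le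
  have hin : tapeMeasure {ω | ∃ t, Halted sampler (run sampler M.input ω t) ∧
      run sampler M.input ω t ∈ S} ≤ .ofReal p := by
    refine measure_halted_in_le hSm fun k => ?_
    have h := start_bound (κ := 0) (F := S.indicator 1) hM le_rfl hnodup hB0 (fun s σ h1 h2 => by
      by_cases hs : s ∈ S
      · have hBσ : B σ = 1 := if_pos ((hmem s σ h1 h2).1 hs)
        rw [Set.indicator_of_mem hs, hBσ, ENNReal.ofReal_one]
        exact le_rfl
      · simp [hs]) k
    rwa [ENNReal.ofReal_zero, zero_mul, zero_add] at h
  have hnotin : tapeMeasure {ω | ∃ t, Halted sampler (run sampler M.input ω t) ∧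
      run sampler M.input ω t ∈ Sᶜ} ≤ .ofReal (1 - p) := by
    refine measure_halted_in_le hSm.compl fun k => ?_
    have h := start_bound (κ := 0) (F := Sᶜ.indicator 1) hM le_rfl hnodup hB1 (fun s σ h1 h2 => by
      by_cases hs : s ∈ S
      · simp [hs]
      · have hBσ : B σ = 0 := if_neg (mt (hmem s σ h1 h2).2 hs)
        rw [Set.indicator_of_mem (Set.mem_compl hs), hBσ, sub_zero, ENNReal.ofReal_one]
        exact le_rfl) k
    rwa [ENNReal.ofReal_zero, zero_mul, zero_add, hcompl] at h
  refine le_antisymm hin ?_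
  -- The reverse inequality: almost every run halts, inside `S` or outside, and the second event has
  -- probability at most `1 - p`.
  have hone : 1 ≤ tapeMeasure {ω | ∃ t, Halted sampler (run sampler M.input ω t) ∧
      run sampler M.input ω t ∈ S} + .ofReal (1 - p) := by
    rw [← measure_univ (μ := tapeMeasure)]
    refine (measure_mono_ae ?_).trans ((measure_union_le _ _).trans (add_le_add_right hnotin _))
    filter_upwards [ae_halted ENNReal.ofReal_ne_top (value_start_le hM hnodup)] with ω hω _
    obtain ⟨t, ht⟩ := hω
    by_cases hs : run sampler M.input ω t ∈ S
    · exact Or.inl ⟨t, ht, hs⟩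
    · exact Or.inr ⟨t, ht, hs⟩
  have hsplit : ENNReal.ofReal p + ENNReal.ofReal (1 - p) = 1 := by
    rw [← ENNReal.ofReal_add hp0 hp1]
    simp
  rw [← hsplit] at hone
  exact (ENNReal.add_le_add_iff_right ENNReal.ofReal_ne_top).1 hone

end

/-! ### The Ising model -/

section

open Ising

variable {n : ℕ} (G : SimpleGraph (Fin n)) [DecidableRel G.Adj] (lam : Fin n → Fin 2 → ℝ) (β : ℝ)

theorem interaction_pos (hβ : 0 < β) (a b : Fin 2) : 0 < interaction β a b := by
  fin_cases a <;> fin_cases b <;> simp [interaction, hβ]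

theorem edgeFactor_pos (hβ : 0 < β) (σ : Fin n → Fin 2) (e : Sym2 (Fin n)) :
    0 < edgeFactor β σ e := by
  induction e with
  | _ u v => exact interaction_pos β hβ _ _

theorem prod_edgeFactor_update (σ : Fin n → Fin 2) (v : Fin n) (c : Fin 2) :
    ∏ e ∈ G.edgeFinset, edgeFactor β (Function.update σ v c) e =
      (∏ u ∈ G.neighborFinset v, interaction β c (σ u)) *
        ∏ e ∈ G.edgeFinset with v ∉ e, edgeFactor β σ e := by
  rw [← Finset.prod_filter_mul_prod_filter_not G.edgeFinset (fun e => v ∈ e)]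
  congr 1
  · have himg : G.edgeFinset.filter (fun e => v ∈ e) =
        (G.neighborFinset v).image fun u => s(v, u) := by
      ext e
      simp only [Finset.mem_filter, SimpleGraph.mem_edgeFinset, Finset.mem_image,
        SimpleGraph.mem_neighborFinset]
      constructor
      · rintro ⟨he, hv⟩
        obtain ⟨u, rfl⟩ := Sym2.mem_iff_exists.1 hv
        exact ⟨u, he, rfl⟩
      · rintro ⟨u, hu, rfl⟩
        exact ⟨hu, Sym2.mem_mk_left v u⟩
    rw [himg, Finset.prod_image fun a _ b _ hab => Sym2.congr_right.1 hab]
    refine Finset.prod_congr rfl fun u hu => ?_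
    have hne : u ≠ v := fun h => G.loopless.irrefl v (by
      rw [SimpleGraph.mem_neighborFinset, h] at hu; exact hu)
    simp [edgeFactor, hne]
  · refine Finset.prod_congr rfl fun e he => ?_
    have hv := (Finset.mem_filter.1 he).2
    induction e with
    | _ x y =>
      rw [Sym2.mem_iff, not_or] at hv
      simp [edgeFactor, Ne.symm hv.1, Ne.symm hv.2]

theorem weight_update (σ : Fin n → Fin 2) (v : Fin n) (c : Fin 2) :
    weight G lam β (Function.update σ v c) =
      lam v c * (∏ u ∈ G.neighborFinset v, interaction β c (σ u)) *
        ((∏ u ∈ Finset.univ.erase v, lam u (σ u)) *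
          ∏ e ∈ G.edgeFinset with v ∉ e, edgeFactor β σ e) := by
  unfold weight
  rw [prod_edgeFactor_update, ← Finset.mul_prod_erase _ _ (Finset.mem_univ v),
    Function.update_self]
  have : ∏ u ∈ Finset.univ.erase v, lam u (Function.update σ v c u) =
      ∏ u ∈ Finset.univ.erase v, lam u (σ u) :=
    Finset.prod_congr rfl fun u hu => by rw [Function.update_of_ne (Finset.ne_of_mem_erase hu)]
  rw [this]
  ring

/-- The Ising model as a model for the sampler. -/
def isingModel (adj : Fin n → List (Fin n)) (query : List (Fin n)) : Model n where
  adj := adj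
  lam := lam
  β := β
  query := query
  Δ := G.maxDegree
  w := weight G lam β

variable {G lam β} {adj : Fin n → List (Fin n)} {query : List (Fin n)}

/-- The mixture decomposition of an edge. The factor does not depend on the spins, so it cancels in
the detailed balance at a vertex. -/
theorem interaction_eq_pass (hβ : 0 < β) (c b : Fin 2) :
    interaction β c b = max 1 β * (isingModel G lam β adj query).pass c b := by
  unfold Model.pass Model.Accepts Model.slack
  by_cases h : β < 1
  · have hm : max 1 β = 1 := max_eq_left h.le
    simp only [isingModel, h, if_true, hm]
    fin_cases c <;> fin_cases b <;> simp [interaction]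
  · have hm : max 1 β = β := max_eq_right (not_lt.1 h)
    simp only [isingModel, h, if_false, hm]
    fin_cases c <;> fin_cases b <;> simp [interaction] <;> field_simp

theorem length_adj (hadj : ∀ v, (adj v).Nodup ∧ ∀ u, u ∈ adj v ↔ G.Adj v u) (v : Fin n) :
    (adj v).length = G.degree v := by
  rw [← List.toFinset_card_of_nodup (hadj v).1, ← SimpleGraph.card_neighborFinset_eq_degree]
  congr 1
  ext u
  simp [(hadj v).2]

theorem isingModel_good (hΔ : 1 ≤ G.maxDegree) (h0 : ∀ v c, 0 ≤ lam v c)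
    (hpos : ∀ v, ∃ c, 0 < lam v c)
    (hβ : β ∈ Set.Ioo (((G.maxDegree : ℝ) - 0.5) / G.maxDegree)
      ((G.maxDegree : ℝ) / ((G.maxDegree : ℝ) - 0.5)))
    (hadj : ∀ v, (adj v).Nodup ∧ ∀ u, u ∈ adj v ↔ G.Adj v u) :
    (isingModel G lam β adj query).Good := by
  have hΔ' : (1 : ℝ) ≤ G.maxDegree := by exact_mod_cast hΔ
  have hlow : (0 : ℝ) < ((G.maxDegree : ℝ) - 0.5) / G.maxDegree :=
    div_pos (by norm_num; linarith) (by linarith)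
  have hβ0 : 0 < β := hlow.trans hβ.1
  have hedge : ∀ σ : Fin n → Fin 2, 0 < ∏ e ∈ G.edgeFinset, edgeFactor β σ e := fun σ =>
    Finset.prod_pos fun e _ => edgeFactor_pos β hβ0 σ e
  refine ⟨fun v => (hadj v).1, fun v => ?_, fun v hv => ?_, hΔ, h0, hpos, hβ0, ?_, fun σ => ?_,
    fun σ hσ => ?_, fun v σ c b => ?_⟩
  · exact (length_adj hadj v).trans_le (G.degree_le_maxDegree v)
  · exact G.loopless.irrefl v (((hadj v).2 v).1 hv)
  -- The two ends of the interval for β give the same lower bound 1 − 1/(2Δ), for β and for 1/β.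
  · have e : 1 - 1 / (2 * (G.maxDegree : ℝ)) = ((G.maxDegree : ℝ) - 0.5) / G.maxDegree := by
      field_simp
      ring
    change 1 - 1 / (2 * (G.maxDegree : ℝ)) ≤ if β < 1 then β else 1 / β
    rw [e]
    split_ifs with h
    · exact hβ.1.le
    · have h2 := one_div_le_one_div_of_le hβ0 hβ.2.le
      rwa [one_div_div] at h2
  · exact mul_nonneg (Finset.prod_nonneg fun v _ => h0 v _) (hedge σ).le
  · exact mul_pos (Finset.prod_pos fun v _ => hσ v) (hedge σ)
  · have hprod : ∀ c, ∏ u ∈ G.neighborFinset v, interaction β c (σ u) =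
        max 1 β ^ G.degree v * (isingModel G lam β adj query).passAll c (adj v) σ := by
      intro c
      have hfin : G.neighborFinset v = (adj v).toFinset := by
        ext u; simp [(hadj v).2]
      simp only [interaction_eq_pass (G := G) (lam := lam) (adj := adj) (query := query) hβ0]
      rw [Finset.prod_mul_distrib, Finset.prod_const, SimpleGraph.card_neighborFinset_eq_degree, hfin,
        List.prod_toFinset _ (hadj v).1]
      rfl
    change weight G lam β (Function.update σ v c) * (lam v b * _) =
      weight G lam β (Function.update σ v b) * (lam v c * _)
    rw [weight_update, weight_update, hprod, hprod]
    change _ * (lam v b * Model.passAll _ b (adj v) σ) = _ * (lam v c * Model.passAll _ c (adj v) σ)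
    ring

open Classical in
theorem marginal_eq (Λ : Finset (Fin n)) (τ : Λ → Fin 2) :
    marginal G lam β Λ τ = (∑ σ, weight G lam β σ * if ∀ v : Λ, σ v = τ v then 1 else 0) /
      ∑ σ, weight G lam β σ := by
  unfold marginal gibbs partitionFunction
  rw [← Finset.sum_div]
  simp [Finset.sum_filter]

end

end LocalSampler

end

/-! ### The theorem with its explicit constant -/

theorem corollary1p3 :
    ∃ (P : RAM.Program) (K : ℕ),
      ∀ (n : ℕ) (G : SimpleGraph (Fin n)) [DecidableRel G.Adj]
        (lam : Fin n → Fin 2 → ℝ) (β : ℝ) (Λ : Finset (Fin n))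
        (adj : Fin n → List (Fin n)) (query : List (Fin n)),
        1 ≤ G.maxDegree →
        (∀ v c, 0 ≤ lam v c) → (∀ v, ∃ c, 0 < lam v c) →
        β ∈ Set.Ioo (((G.maxDegree : ℝ) - 0.5) / G.maxDegree)
          ((G.maxDegree : ℝ) / ((G.maxDegree : ℝ) - 0.5)) →
        (∀ v, (adj v).Nodup ∧ ∀ u, u ∈ adj v ↔ G.Adj v u) →
        query.Nodup → (∀ v, v ∈ query ↔ v ∈ Λ) →
        (∀ τ : Λ → Fin 2,
          RAM.tapeMeasure {ω | RAM.Outputs P ⟨n, adj, lam, β, query⟩ τ ω} =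
            ENNReal.ofReal (Ising.marginal G lam β Λ τ)) ∧
        ∫⁻ ω, RAM.runtime P ⟨n, adj, lam, β, query⟩ ω ∂(RAM.tapeMeasure) ≤
          ((K * max 1 (G.maxDegree * Λ.card) : ℕ) : ENNReal) := by
  classical
  -- 2002 = 11 + 1190 + 801: the bound 11 + (9(130 + 89Δ) + 20)|Λ| has the terms 11, 1190|Λ| and
  -- 801Δ|Λ|, and each of 1, |Λ|, Δ|Λ| is at most max(1, Δ|Λ|).
  refine ⟨LocalSampler.sampler, 2002, ?_⟩
  intro n G _ lam β Λ adj query hΔ h0 hpos hβ hadj hnodup hquery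
  have hM := LocalSampler.isingModel_good (query := query) hΔ h0 hpos hβ hadj
  refine ⟨fun τ => ?_, (RAM.lintegral_runtime_le
    (LocalSampler.value_start_le hM hnodup)).trans ?_⟩
  · rw [LocalSampler.marginal_eq]
    exact LocalSampler.measure_outputs hM hnodup hquery τ
  · rw [← ENNReal.ofReal_natCast]
    refine ENNReal.ofReal_le_ofReal ?_
    have hlen : query.length = Λ.card := by
      rw [← List.toFinset_card_of_nodup hnodup]
      congr 1
      ext v
      simpa using hquery v
    change 11 + (9 * (130 + 89 * (G.maxDegree : ℝ)) + 20) * (query.length : ℝ) ≤ _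
    rw [hlen]
    push_cast
    have hΔ' : (1 : ℝ) ≤ G.maxDegree := by exact_mod_cast hΔ
    have h1 : (1 : ℝ) ≤ max 1 ((G.maxDegree : ℝ) * Λ.card) := le_max_left _ _
    have h2 : (G.maxDegree : ℝ) * Λ.card ≤ max 1 ((G.maxDegree : ℝ) * Λ.card) := le_max_right _ _
    have h3 : (Λ.card : ℝ) ≤ (G.maxDegree : ℝ) * Λ.card :=
      le_mul_of_one_le_left (Nat.cast_nonneg _) hΔ'
    linarith
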